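/- **Theorem (perfect hydrodynamic cloaking and shielding for confocal ellipses).** Let $l>0$ and let $(\xi,\eta)$, $\xi\ge 0$, $0\le\eta<2\pi$, be the elliptic coordinates of the plane, $x_1=l\cosh\xi\cos\eta$, $x_2=l\sinh\xi\sin\eta$. Let $0<\xi_i<\xi_e$, and let $D=\{\xi<\xi_i\}$ and $\Omega=\{\xi<\xi_e\}$ be the confocal elliptic domains of elliptic radii $\xi_i$ and $\xi_e$. For $\zeta_0\in\mathbb R$ and harmonic $H,P:\mathbb R^2\to\mathbb R$ consider the system for $(\varphi,p)$ $$ \begin{cases} \Delta\varphi=0 & \text{in }\mathbb R^2\setminus\overline D,\\ \partial\varphi/\partial\nu=0 & \text{on }\partial D,\\ \varphi=H+O(|x|^{-1}) & \text{as }|x|\to\infty,\\ \Delta p=0 & \text{in }(\mathbb R^2\setminus\overline D)\setminus\partial\Omega,\\ \partial p/\partial\nu=0 & \text{on }\partial D,\\ p|_+=p|_- & \text{on }\partial\Omega,\\ \frac{\partial p}{\partial\nu}\big|_+-\frac{\partial p}{\partial\nu}\big|_-=12\,\zeta_0\,\frac{\partial\varphi}{\partial\nu} & \text{on }\partial\Omega,\\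 p=P+O(|x|^{-1}) & \text{as }|x|\to\infty, \end{cases} $$ where $\nu$ is the outward unit normal of the respective ellipse, $\frac{\partial f}{\partial\nu}|_\pm(x)=\lim_{t\to0^+}\langle\nabla f(x\pm t\nu(x)),\nu(x)\rangle$, and the conditions on $\partial D$ are understood with the limit from outside. A classical solution is a pair $\varphi,p$ of functions continuous on $\mathbb R^2\setminus D$, with $\varphi$ of class $C^2$ in $\mathbb R^2\setminus\overline D$ and $p$ of class $C^2$ in $(\mathbb R^2\setminus\overline D)\setminus\partial\Omega$, that satisfies the system. Let $\zeta_{mean}=\zeta_0$ in $\Omega\setminus\overline D$ and $\zeta_{mean}=0$ in $\mathbb R^2\setminus\overline\Omega$, let $u=-\frac1{12}\nabla p-\zeta_{mean}\nabla\varphi$ be the averaged velocity, and let $F=\int_{\partial D}(-p)\,\nu\,ds$ be the force on the object. *Perfect cloaking* means that the system has a classical solution and that every classical solution satisfies $u=-\nabla P/12$ in $\mathbb R^2\setminus\overline\Omega$; *perfect shielding* means that the system has a classical solution and that every classical solution satisfies $F=0$. Let $n\ge1$ be an integer. 1. Let $H=\cosh(n\xi)\cos(n\eta)$ and $P=12\cosh(n\xi)\cos(n\eta)$.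 Perfect cloaking holds for $$\zeta_0=\frac{\sinh(n\xi_i)}{\big(\sinh(n\xi_e)-e^{n(\xi_i-\xi_e)}\sinh(n\xi_i)\big)\cosh(n(\xi_e-\xi_i))},$$ and perfect shielding holds for $$\zeta_0=\frac{e^{n\xi_e}}{\sinh(n\xi_e)-e^{n(\xi_i-\xi_e)}\sinh(n\xi_i)}.$$ 2. Let $H=\sinh(n\xi)\sin(n\eta)$ and $P=12\sinh(n\xi)\sin(n\eta)$. Perfect cloaking holds for $$\zeta_0=\frac{\cosh(n\xi_i)}{\big(\cosh(n\xi_e)-e^{n(\xi_i-\xi_e)}\cosh(n\xi_i)\big)\cosh(n(\xi_e-\xi_i))},$$ and perfect shielding holds for $$\zeta_0=\frac{e^{n\xi_e}}{\cosh(n\xi_e)-e^{n(\xi_i-\xi_e)}\cosh(n\xi_i)}.$$ 3. The two shielding values in 1 and 2 coincide. -/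

import Mathlib

open Filter Topology MeasureTheory Asymptotics
open scoped Gradient

noncomputable section

namespace ElectroOsmosis

/-- The Euclidean plane `ℝ²`. -/
abbrev Plane : Type := EuclideanSpace ℝ (Fin 2)

/-! ### Outward normals and one-sided normal derivatives -/

/-- `ν` is the outward unit normal at the boundary point `x` of a set `U` with `C¹` boundary near
`x`: locally `U = {ρ < 0}` for a `C¹` function `ρ` with `ρ x = 0`, and `∇ρ(x)` is a positive
multiple of the unit vector `ν`. -/
def IsOutwardUnitNormal (U : Set Plane) (x ν : Plane) : Prop :=
  ‖ν‖ = 1 ∧ ∃ ρ : Plane → ℝ, ContDiffAt ℝ 1 ρ x ∧ ρ x = 0 ∧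
    (∃ c : ℝ, 0 < c ∧ ∇ ρ x = c • ν) ∧ ∀ᶠ y in 𝓝 x, (y ∈ U ↔ ρ y < 0)

open Classical in
/-- The outward unit normal field of `U` (with the value `0` where there is no normal). -/
def outwardNormal (U : Set Plane) (x : Plane) : Plane :=
  if h : ∃ ν, IsOutwardUnitNormal U x ν then h.choose else 0

/-- `∂f/∂ν|₊ (x) = a`, the limit of `⟨∇f(x + tν), ν⟩` as `t → 0⁺`. -/
def HasOuterNormalDeriv (U : Set Plane) (f : Plane → ℝ) (x : Plane) (a : ℝ) : Prop :=
  Tendsto (fun t : ℝ => inner ℝ (∇ f (x + t • outwardNormal U x)) (outwardNormal U x))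
    (𝓝[>] 0) (𝓝 a)

/-- `∂f/∂ν|₋ (x) = a`, the limit of `⟨∇f(x - tν), ν⟩` as `t → 0⁺`. -/
def HasInnerNormalDeriv (U : Set Plane) (f : Plane → ℝ) (x : Plane) (a : ℝ) : Prop :=
  Tendsto (fun t : ℝ => inner ℝ (∇ f (x - t • outwardNormal U x)) (outwardNormal U x))
    (𝓝[>] 0) (𝓝 a)

/-! ### The electro-osmotic system -/

/-- The zeta potential: `ζ₀` in the control region `Ω ∖ closure D`, and `0` elsewhere. -/
def zetaMean (D Ω : Set Plane) (ζ₀ : ℝ) : Plane → ℝ :=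
  (Ω \ closure D).indicator fun _ => ζ₀

/-- `(φ, p)` is a classical solution of the electro-osmotic system for the object `D`, the outer
domain `Ω`, the zeta potential `ζ₀` and the background fields `H`, `P`. The functions are total;
their values in `D` play no role. -/
structure IsSolution (D Ω : Set Plane) (ζ₀ : ℝ) (H P φ p : Plane → ℝ) : Prop where
  /-- `φ` is continuous up to the boundary of the object. -/
  phi_cont : ContinuousOn φ Dᶜ
  /-- `φ` is `C²` with `Δφ = 0` outside the closure of the object. -/
  phi_harmonic : InnerProductSpace.HarmonicOnNhd φ (closure D)ᶜ
  /-- `∂φ/∂ν = 0` on `∂D`. -/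
  phi_neumann : ∀ x ∈ frontier D, HasOuterNormalDeriv D φ x 0
  /-- `φ = H + O(|x|⁻¹)` at infinity. -/
  phi_infty : (fun x => φ x - H x) =O[Bornology.cobounded Plane] fun x => ‖x‖⁻¹
  /-- `p` is continuous up to the boundary of the object; in particular `p|₊ = p|₋` on `∂Ω`. -/
  p_cont : ContinuousOn p Dᶜ
  /-- `p` is `C²` with `Δp = 0` outside the closure of the object, on both sides of `∂Ω`. -/
  p_harmonic : InnerProductSpace.HarmonicOnNhd p ((closure D)ᶜ \ frontier Ω)
  /-- `∂p/∂ν = 0` on `∂D`. -/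
  p_neumann : ∀ x ∈ frontier D, HasOuterNormalDeriv D p x 0
  /-- `∂p/∂ν|₊ - ∂p/∂ν|₋ = 12 ζ₀ ∂φ/∂ν` on `∂Ω`, both one-sided limits existing. -/
  p_jump : ∀ x ∈ frontier Ω, ∃ a b : ℝ, HasOuterNormalDeriv Ω p x a ∧
    HasInnerNormalDeriv Ω p x b ∧ a - b = 12 * ζ₀ * inner ℝ (∇ φ x) (outwardNormal Ω x)
  /-- `p = P + O(|x|⁻¹)` at infinity. -/
  p_infty : (fun x => p x - P x) =O[Bornology.cobounded Plane] fun x => ‖x‖⁻¹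

/-- The depth-averaged velocity `u = -∇p/12 - ζ ∇φ`. -/
def averVelocity (D Ω : Set Plane) (ζ₀ : ℝ) (φ p : Plane → ℝ) (x : Plane) : Plane :=
  -((1 / 12 : ℝ) • ∇ p x) - zetaMean D Ω ζ₀ x • ∇ φ x

/-- The force on the object, the integral of `σ ν` over `∂D` with respect to arc length, where
`σ = -p I`. -/
def force (D : Set Plane) (p : Plane → ℝ) : Plane :=
  ∫ x in frontier D, (-p x) • outwardNormal D x ∂(Measure.hausdorffMeasure 1)

/-- Perfect hydrodynamic cloaking: the system is solvable, and the velocity of its solution is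
`-∇P/12` outside the closure of `Ω`. -/
def IsPerfectCloaking (D Ω : Set Plane) (ζ₀ : ℝ) (H P : Plane → ℝ) : Prop :=
  (∃ φ p, IsSolution D Ω ζ₀ H P φ p) ∧
    ∀ φ p, IsSolution D Ω ζ₀ H P φ p →
      ∀ x ∈ (closure Ω)ᶜ, averVelocity D Ω ζ₀ φ p x = -((1 / 12 : ℝ) • ∇ P x)

/-- Perfect hydrodynamic shielding: the system is solvable, and the force that its solution exerts
on the object vanishes. -/
def IsPerfectShielding (D Ω : Set Plane) (ζ₀ : ℝ) (H P : Plane → ℝ) : Prop :=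
  (∃ φ p, IsSolution D Ω ζ₀ H P φ p) ∧
    ∀ φ p, IsSolution D Ω ζ₀ H P φ p → force D p = 0

/-! ### Elliptic coordinates -/

/-- The point with elliptic coordinates `(ξ, η)`, for the foci `(±l, 0)`. -/
def ellipticPoint (l ξ η : ℝ) : Plane :=
  !₂[l * Real.cosh ξ * Real.cos η, l * Real.sinh ξ * Real.sin η]

/-- The open domain bounded by the ellipse of elliptic radius `r` with foci `(±l, 0)`. -/
def ellipse (l r : ℝ) : Set Plane :=
  {x | ∃ ξ η : ℝ, 0 ≤ ξ ∧ ξ < r ∧ x = ellipticPoint l ξ η}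

theorem exists_ellipticCoords {l : ℝ} (hl : 0 < l) (x : Plane) :
    ∃ c : ℝ × ℝ, 0 ≤ c.1 ∧ 0 ≤ c.2 ∧ c.2 < 2 * Real.pi ∧ ellipticPoint l c.1 c.2 = x := by
  have key : ∃ ξ η : ℝ, 0 ≤ ξ ∧ ellipticPoint l ξ η = x := by
    obtain ⟨w, hw⟩ := Complex.cos_surjective (⟨x 0 / l, x 1 / l⟩ : ℂ)
    have h0 : Real.cos w.re * Real.cosh w.im = x 0 / l := by
      have := congrArg Complex.re hw
      rw [Complex.cos_eq] at this
      simpa [← Complex.ofReal_cos, ← Complex.ofReal_sin, ← Complex.ofReal_cosh,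
        ← Complex.ofReal_sinh] using this
    have h1 : -(Real.sin w.re * Real.sinh w.im) = x 1 / l := by
      have := congrArg Complex.im hw
      rw [Complex.cos_eq] at this
      simpa [← Complex.ofReal_cos, ← Complex.ofReal_sin, ← Complex.ofReal_cosh,
        ← Complex.ofReal_sinh] using this
    rw [eq_div_iff hl.ne'] at h0 h1
    rcases le_total 0 w.im with h | h
    · refine ⟨w.im, -w.re, h, ?_⟩
      ext i
      fin_cases i
      · simp only [ellipticPoint, Real.cos_neg]
        simpa [mul_comm, mul_assoc, mul_left_comm] using h0
      · simp only [ellipticPoint, Real.sin_neg]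
        simpa [mul_comm, mul_assoc, mul_left_comm] using h1
    · refine ⟨-w.im, w.re, neg_nonneg.2 h, ?_⟩
      ext i
      fin_cases i
      · simp only [ellipticPoint, Real.cosh_neg]
        simpa [mul_comm, mul_assoc, mul_left_comm] using h0
      · simp only [ellipticPoint, Real.sinh_neg]
        simpa [mul_comm, mul_assoc, mul_left_comm] using h1
  obtain ⟨ξ, η, hξ, hx⟩ := key
  refine ⟨(ξ, toIcoMod Real.two_pi_pos 0 η), hξ, ?_, ?_, ?_⟩
  · exact (toIcoMod_mem_Ico Real.two_pi_pos 0 η).1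
  · simpa using (toIcoMod_mem_Ico Real.two_pi_pos 0 η).2
  · rw [← hx]
    simp only [ellipticPoint, toIcoMod, zsmul_eq_mul, Real.cos_sub_int_mul_two_pi,
      Real.sin_sub_int_mul_two_pi]

open Classical in
/-- Elliptic coordinates `(ξ, η)` of a point, `ξ ≥ 0` and `0 ≤ η < 2π`. They are unique off the open
segment between the foci. -/
def ellipticCoords (l : ℝ) (x : Plane) : ℝ × ℝ :=
  Classical.epsilon fun c : ℝ × ℝ =>
    0 ≤ c.1 ∧ 0 ≤ c.2 ∧ c.2 < 2 * Real.pi ∧ ellipticPoint l c.1 c.2 = x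

theorem ellipticCoords_spec {l : ℝ} (hl : 0 < l) (x : Plane) :
    0 ≤ (ellipticCoords l x).1 ∧ 0 ≤ (ellipticCoords l x).2 ∧
      (ellipticCoords l x).2 < 2 * Real.pi ∧
      ellipticPoint l (ellipticCoords l x).1 (ellipticCoords l x).2 = x :=
  Classical.epsilon_spec (exists_ellipticCoords hl x)

/-- The background field `cosh(nξ) cos(nη)`. -/
def fieldCos (l : ℝ) (n : ℕ) (x : Plane) : ℝ :=
  Real.cosh (n * (ellipticCoords l x).1) * Real.cos (n * (ellipticCoords l x).2)

/-- The background field `sinh(nξ) sin(nη)`. -/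
def fieldSin (l : ℝ) (n : ℕ) (x : Plane) : ℝ :=
  Real.sinh (n * (ellipticCoords l x).1) * Real.sin (n * (ellipticCoords l x).2)

theorem cosh_nat_mul (n : ℕ) (ξ η : ℝ) :
    Complex.cosh (n * (ξ + η * Complex.I)) =
      ⟨Real.cosh (n * ξ) * Real.cos (n * η), Real.sinh (n * ξ) * Real.sin (n * η)⟩ := by
  have h : (n * (ξ + η * Complex.I) : ℂ) = ((n * ξ : ℝ) : ℂ) + ((n * η : ℝ) : ℂ) * Complex.I := by
    push_cast; ring
  rw [h]
  generalize (n * ξ : ℝ) = a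
  generalize (n * η : ℝ) = b
  rw [Complex.cosh_add, Complex.cosh_mul_I, Complex.sinh_mul_I, ← Complex.ofReal_cosh,
    ← Complex.ofReal_sinh, ← Complex.ofReal_cos, ← Complex.ofReal_sin]
  apply Complex.ext <;> simp [-Complex.ofReal_sinh, -Complex.ofReal_cosh,
    -Complex.ofReal_sin, -Complex.ofReal_cos]

/-- The fields do not depend on the choice of the elliptic coordinates of a point. -/
theorem field_ellipticPoint {l : ℝ} (hl : 0 < l) (n : ℕ) (ξ η : ℝ) :
    fieldCos l n (ellipticPoint l ξ η) = Real.cosh (n * ξ) * Real.cos (n * η) ∧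
      fieldSin l n (ellipticPoint l ξ η) = Real.sinh (n * ξ) * Real.sin (n * η) := by
  obtain ⟨-, -, -, h⟩ := ellipticCoords_spec hl (ellipticPoint l ξ η)
  set c := ellipticCoords l (ellipticPoint l ξ η) with hc
  have h0 := congrArg (fun y : Plane => y 0) h
  have h1 := congrArg (fun y : Plane => y 1) h
  simp only [ellipticPoint, PiLp.toLp_apply, Matrix.cons_val_zero, Matrix.cons_val_one,
    mul_assoc] at h0 h1
  have h0' := mul_left_cancel₀ hl.ne' h0
  have h1' := mul_left_cancel₀ hl.ne' h1
  have e : Complex.cosh (c.1 + c.2 * Complex.I) = Complex.cosh (ξ + η * Complex.I) := by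
    have a := cosh_nat_mul 1 c.1 c.2
    have b := cosh_nat_mul 1 ξ η
    simp only [Nat.cast_one, one_mul] at a b
    rw [a, b, h0', h1']
  have e' : Complex.cosh (n * (c.1 + c.2 * Complex.I)) =
      Complex.cosh (n * (ξ + η * Complex.I)) := by
    have a := Polynomial.Chebyshev.T_complex_cosh (c.1 + c.2 * Complex.I) n
    have b := Polynomial.Chebyshev.T_complex_cosh (ξ + η * Complex.I) n
    rw [e] at a
    simpa using a.symm.trans b
  rw [cosh_nat_mul, cosh_nat_mul, Complex.mk.injEq] at e'
  exact e'

end ElectroOsmosis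

end

open ElectroOsmosis

open ElectroOsmosis

namespace ElectroOsmosis

open InnerProductSpace Laplacian

/-! The theorem splits into uniqueness, which transfers properties of one explicit solution to every
classical solution, and an explicit solution by separation of variables.

Uniqueness of `φ`, and then of `p`, on the complement of `D` (`IsSolution.unique`) comes from a
maximum principle. The difference `w` of two solutions is harmonic off `∂Ω`, has zero Neumann data
on `∂D`, equal normal derivatives on the two sides of `∂Ω`, and tends to 0 at infinity. Adding `ε
(|x|² + max(0, ρ))`, with `ρ` the quadratic form of `∂Ω`, excludes local maxima everywhere on the
complement of `D` (`not_isMax_add_kinkBarrier`): the sum is strictly subharmonic off `∂Ω`, strictly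
increasing along the normal at `∂D`, and has a convex kink at `∂Ω`. Decay at infinity and `ε → 0`
then give `w ≤ 0`, and `-w` gives the rest. No regularity of `w` across `∂Ω` is needed.

Existence rests on the conformal map `w ↦ l cosh w`: the functions `(A e^{nξ} + B e^{-nξ}) cos(nη -
θ)` are harmonic (`harmonicAt_mode`), with `θ = 0` and `θ = π/2` covering both backgrounds. On a
confocal ellipse all their normal derivatives are radial derivatives times one common factor, so the
system becomes linear algebra in the coefficients (`isSolution_mode`). In both cases the radial part
of `φ` is `e^{nξi} cosh(n(ξ - ξi))`. For cloaking, `p` equals the background outside `Ω` and `C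
cosh(n(ξ - ξi)) cos(nη - θ)` between the ellipses; for shielding, `p` vanishes between them. The
jump condition then determines `ζ₀`. -/

/-! ### Ellipses as sublevel sets -/

/-- The quadratic polynomial that is negative inside the ellipse of elliptic radius `r`. -/
noncomputable def ellipseForm (l r : ℝ) (x : Plane) : ℝ :=
  (x 0 / (l * Real.cosh r)) ^ 2 + (x 1 / (l * Real.sinh r)) ^ 2 - 1

/-- The gradient of `ellipseForm`. -/
noncomputable def ellipseGrad (l r : ℝ) (x : Plane) : Plane :=
  !₂[2 * x 0 / (l * Real.cosh r) ^ 2, 2 * x 1 / (l * Real.sinh r) ^ 2]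

theorem inner_plane (x y : Plane) : inner ℝ x y = x 0 * y 0 + x 1 * y 1 := by
  simp [PiLp.inner_apply, Fin.sum_univ_two, mul_comm]

theorem norm_sq_plane (x : Plane) : ‖x‖ ^ 2 = x 0 ^ 2 + x 1 ^ 2 := by
  simp [EuclideanSpace.norm_sq_eq, Fin.sum_univ_two]

theorem contDiff_ellipseForm (l r : ℝ) {k : WithTop ℕ∞} : ContDiff ℝ k (ellipseForm l r) := by
  unfold ellipseForm
  fun_prop

theorem continuous_ellipseForm (l r : ℝ) : Continuous (ellipseForm l r) :=
  (contDiff_ellipseForm l r (k := 0)).continuous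

/-- The second-order Taylor expansion is exact for a quadratic, and its last coefficient is
nonnegative. This convexity makes the later statements along the outward ray valid for all `t > 0`.
-/
theorem ellipseForm_add_smul (l r : ℝ) (x v : Plane) (t : ℝ) :
    ellipseForm l r (x + t • v) = ellipseForm l r x + t * inner ℝ (ellipseGrad l r x) v +
      t ^ 2 * (ellipseForm l r v + 1) := by
  simp only [ellipseForm, ellipseGrad, inner_plane, PiLp.add_apply, PiLp.smul_apply, smul_eq_mul,
    Matrix.cons_val_zero, Matrix.cons_val_one]
  ring

theorem ellipseForm_add_one_nonneg (l r : ℝ) (x : Plane) : 0 ≤ ellipseForm l r x + 1 := by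
  unfold ellipseForm
  nlinarith [sq_nonneg (x 0 / (l * Real.cosh r)), sq_nonneg (x 1 / (l * Real.sinh r))]

theorem hasDerivAt_ellipseForm_line (l r : ℝ) (x v : Plane) :
    HasDerivAt (fun t : ℝ => ellipseForm l r (x + t • v)) (inner ℝ (ellipseGrad l r x) v) 0 := by
  simp only [ellipseForm_add_smul]
  refine (((((hasDerivAt_id (0 : ℝ)).mul_const (inner ℝ (ellipseGrad l r x) v)).const_add
    (ellipseForm l r x)).fun_add
    (((hasDerivAt_id (0 : ℝ)).fun_pow 2).mul_const (ellipseForm l r v + 1)))).congr_deriv ?_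
  simp

theorem gradient_ellipseForm (l r : ℝ) (x : Plane) :
    ∇ (ellipseForm l r) x = ellipseGrad l r x := by
  refine ext_inner_right ℝ fun v => ?_
  have hd : DifferentiableAt ℝ (ellipseForm l r) x :=
    (contDiff_ellipseForm l r (k := 1)).differentiable one_ne_zero x
  rw [inner_gradient_left]
  have hd' : HasFDerivAt (ellipseForm l r) (fderiv ℝ (ellipseForm l r) x) (x + (0 : ℝ) • v) := by
    simpa using hd.hasFDerivAt
  have hl : HasDerivAt (fun t : ℝ => x + t • v) v 0 := by
    simpa using ((hasDerivAt_id (0 : ℝ)).smul_const v).const_add x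
  have h := hd'.comp_hasDerivAt (0 : ℝ) hl
  exact h.unique (hasDerivAt_ellipseForm_line l r x v)

theorem ellipseForm_ellipticPoint {l r : ℝ} (hl : 0 < l) (ξ η : ℝ) :
    ellipseForm l r (ellipticPoint l ξ η) =
      (Real.cosh ξ / Real.cosh r) ^ 2 * Real.cos η ^ 2 +
        (Real.sinh ξ / Real.sinh r) ^ 2 * Real.sin η ^ 2 - 1 := by
  simp only [ellipseForm, ellipticPoint, PiLp.toLp_apply, Matrix.cons_val_zero, Matrix.cons_val_one,
    mul_assoc]
  rw [mul_div_mul_left _ _ hl.ne', mul_div_mul_left _ _ hl.ne']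
  ring

theorem ellipseForm_ellipticPoint_self {l r : ℝ} (hl : 0 < l) (hr : 0 < r) (η : ℝ) :
    ellipseForm l r (ellipticPoint l r η) = 0 := by
  rw [ellipseForm_ellipticPoint hl, div_self (Real.cosh_pos r).ne',
    div_self (Real.sinh_pos_iff.2 hr).ne']
  linarith [Real.sin_sq_add_cos_sq η]

theorem ellipseForm_ellipticPoint_neg {l r : ℝ} (hl : 0 < l) (hr : 0 < r) {ξ : ℝ} (h0 : 0 ≤ ξ)
    (h : ξ < r) (η : ℝ) : ellipseForm l r (ellipticPoint l ξ η) < 0 := by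
  rw [ellipseForm_ellipticPoint hl]
  have hs := Real.sinh_pos_iff.2 hr
  have h1 : (Real.cosh ξ / Real.cosh r) ^ 2 < 1 := by
    rw [sq_lt_one_iff₀ (by positivity), div_lt_one (Real.cosh_pos r), Real.cosh_lt_cosh,
      abs_of_nonneg h0, abs_of_pos hr]
    exact h
  have h2 : (Real.sinh ξ / Real.sinh r) ^ 2 < 1 := by
    rw [sq_lt_one_iff₀ (div_nonneg (Real.sinh_nonneg_iff.2 h0) hs.le), div_lt_one hs,
      Real.sinh_lt_sinh]
    exact h
  have h3 := Real.sin_sq_add_cos_sq η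
  rcases (sq_nonneg (Real.sin η)).eq_or_lt with h4 | h4
  · nlinarith
  · nlinarith [sq_nonneg (Real.cos η)]

theorem ellipseForm_ellipticPoint_pos {l r : ℝ} (hl : 0 < l) (hr : 0 < r) {ξ : ℝ}
    (h : r < ξ) (η : ℝ) : 0 < ellipseForm l r (ellipticPoint l ξ η) := by
  rw [ellipseForm_ellipticPoint hl]
  have hs := Real.sinh_pos_iff.2 hr
  have h1 : 1 < (Real.cosh ξ / Real.cosh r) ^ 2 := by
    rw [one_lt_sq_iff₀ (by positivity), one_lt_div (Real.cosh_pos r), Real.cosh_lt_cosh,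
      abs_of_pos hr, abs_of_pos (hr.trans h)]
    exact h
  have h2 : 1 < (Real.sinh ξ / Real.sinh r) ^ 2 := by
    rw [one_lt_sq_iff₀ (div_nonneg (Real.sinh_nonneg_iff.2 (hr.trans h).le) hs.le), one_lt_div hs,
      Real.sinh_lt_sinh]
    exact h
  have h3 := Real.sin_sq_add_cos_sq η
  rcases (sq_nonneg (Real.sin η)).eq_or_lt with h4 | h4
  · nlinarith
  · nlinarith [sq_nonneg (Real.cos η)]

theorem mem_ellipse_iff {l r : ℝ} (hl : 0 < l) (hr : 0 < r) (x : Plane) :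
    x ∈ ellipse l r ↔ ellipseForm l r x < 0 := by
  constructor
  · rintro ⟨ξ, η, h0, h, rfl⟩
    exact ellipseForm_ellipticPoint_neg hl hr h0 h η
  · intro h
    obtain ⟨⟨ξ, η⟩, h0, -, -, rfl⟩ := exists_ellipticCoords hl x
    refine ⟨ξ, η, h0, ?_, rfl⟩
    by_contra! hc
    rcases hc.eq_or_lt with hc | hc
    · subst hc
      exact h.ne (ellipseForm_ellipticPoint_self hl hr η)
    · exact h.not_gt (ellipseForm_ellipticPoint_pos hl hr hc η)

theorem ellipse_eq {l r : ℝ} (hl : 0 < l) (hr : 0 < r) :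
    ellipse l r = {x | ellipseForm l r x < 0} :=
  Set.ext (mem_ellipse_iff hl hr)

theorem isOpen_ellipse {l r : ℝ} (hl : 0 < l) (hr : 0 < r) : IsOpen (ellipse l r) := by
  rw [ellipse_eq hl hr]
  exact isOpen_lt (continuous_ellipseForm l r) continuous_const

theorem closure_ellipse {l r : ℝ} (hl : 0 < l) (hr : 0 < r) :
    closure (ellipse l r) = {x | ellipseForm l r x ≤ 0} := by
  rw [ellipse_eq hl hr]
  refine (closure_lt_subset_le (continuous_ellipseForm l r) continuous_const).antisymm ?_
  intro x hx
  -- The ellipse is star-shaped about the origin: `x` is approached from inside by `t • x` with `t <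
  -- 1`.
  have ht : Tendsto (fun t : ℝ => t • x) (𝓝[<] 1) (𝓝 x) := by
    have : Tendsto (fun t : ℝ => t • x) (𝓝 1) (𝓝 ((1 : ℝ) • x)) :=
      (continuous_id.smul continuous_const).tendsto 1
    rw [one_smul] at this
    exact this.mono_left nhdsWithin_le_nhds
  refine mem_closure_of_tendsto ht ?_
  filter_upwards [Ioo_mem_nhdsLT (zero_lt_one (α := ℝ))] with t htt
  have e : ellipseForm l r (t • x) = t ^ 2 * (ellipseForm l r x + 1) - 1 := by
    simp only [ellipseForm, PiLp.smul_apply, smul_eq_mul]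
    ring
  have hx' : ellipseForm l r x ≤ 0 := hx
  have h1 : t ^ 2 < 1 := by nlinarith [htt.1, htt.2]
  change ellipseForm l r (t • x) < 0
  rw [e]
  nlinarith [sq_nonneg t]

theorem frontier_ellipse {l r : ℝ} (hl : 0 < l) (hr : 0 < r) :
    frontier (ellipse l r) = {x | ellipseForm l r x = 0} := by
  rw [(isOpen_ellipse hl hr).frontier_eq, closure_ellipse hl hr, ellipse_eq hl hr]
  ext x
  simp only [Set.mem_sdiff, Set.mem_ofPred_eq, not_lt]
  exact le_antisymm_iff.symm

theorem exists_ellipticPoint_of_ellipseForm_eq_zero {l r : ℝ} (hl : 0 < l) (hr : 0 < r) {x : Plane}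
    (hx : ellipseForm l r x = 0) : ∃ η, x = ellipticPoint l r η := by
  obtain ⟨⟨ξ, η⟩, h0, -, -, rfl⟩ := exists_ellipticCoords hl x
  rcases lt_trichotomy ξ r with h | h | h
  · exact absurd hx (ellipseForm_ellipticPoint_neg hl hr h0 h η).ne
  · exact ⟨η, by rw [← h]⟩
  · exact absurd hx (ellipseForm_ellipticPoint_pos hl hr h η).ne'

/-! ### The outward normal -/

theorem eventually_neg_of_hasGradientAt {ρ : Plane → ℝ} {x v : Plane}
    (hρ : DifferentiableAt ℝ ρ x) (h0 : ρ x = 0) (hv : inner ℝ (∇ ρ x) v < 0) :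
    ∀ᶠ t in 𝓝[>] (0 : ℝ), ρ (x + t • v) < 0 := by
  have hl : HasDerivAt (fun t : ℝ => x + t • v) v 0 := by
    simpa using ((hasDerivAt_id (0 : ℝ)).smul_const v).const_add x
  have hd' : HasFDerivAt ρ (fderiv ℝ ρ x) (x + (0 : ℝ) • v) := by
    simpa using hρ.hasFDerivAt
  have h := hd'.comp_hasDerivAt (0 : ℝ) hl
  rw [inner_gradient_left] at hv
  have hs := hasDerivAt_iff_tendsto_slope.1 h
  have hs' := (hs.mono_left (nhdsGT_le_nhdsNE (0 : ℝ))).eventually (eventually_lt_nhds hv)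
  filter_upwards [hs', self_mem_nhdsWithin] with t h1 h2
  have h2' : (0 : ℝ) < t := h2
  simp only [slope_def_field, Function.comp, zero_smul, add_zero, h0, sub_zero] at h1
  rwa [div_lt_iff₀ h2', zero_mul] at h1

/-- Two distinct unit normals would give a direction `ν₂ - ν₁` along which one defining function
decreases and the other increases, so nearby points would lie both in `U` and outside it. Uniqueness
is what identifies `outwardNormal`, defined by choice. -/
theorem IsOutwardUnitNormal.eq {U : Set Plane} {x ν₁ ν₂ : Plane}
    (h₁ : IsOutwardUnitNormal U x ν₁) (h₂ : IsOutwardUnitNormal U x ν₂) : ν₁ = ν₂ := by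
  obtain ⟨n₁, ρ₁, d₁, z₁, ⟨c₁, hc₁, g₁⟩, e₁⟩ := h₁
  obtain ⟨n₂, ρ₂, d₂, z₂, ⟨c₂, hc₂, g₂⟩, e₂⟩ := h₂
  by_contra hne
  have hlt : inner ℝ ν₁ ν₂ < 1 := (inner_lt_one_iff_real_of_norm_eq_one n₁ n₂).2 hne
  set v := ν₂ - ν₁ with hv
  have i₁ : inner ℝ ν₁ v < 0 := by
    rw [hv, inner_sub_right, real_inner_self_eq_norm_sq, n₁]
    linarith
  have i₂ : 0 < inner ℝ ν₂ v := by
    rw [hv, inner_sub_right, real_inner_self_eq_norm_sq, n₂, real_inner_comm]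
    linarith
  have k₁ := eventually_neg_of_hasGradientAt (v := v) (d₁.differentiableAt one_ne_zero) z₁
    (by rw [g₁, real_inner_smul_left]; exact mul_neg_of_pos_of_neg hc₁ i₁)
  have k₂ := eventually_neg_of_hasGradientAt (v := v) (ρ := fun y => -ρ₂ y)
    (d₂.differentiableAt one_ne_zero).neg (by simp [z₂])
    (by
      rw [inner_gradient_left, fderiv_fun_neg, neg_apply, ← inner_gradient_left,
        g₂, real_inner_smul_left]
      exact neg_neg_of_pos (mul_pos hc₂ i₂))
  have ht : Tendsto (fun t : ℝ => x + t • v) (𝓝[>] 0) (𝓝 x) := by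
    have : Tendsto (fun t : ℝ => x + t • v) (𝓝 0) (𝓝 (x + (0 : ℝ) • v)) :=
      (continuous_const.add (continuous_id.smul continuous_const)).tendsto 0
    rw [zero_smul, add_zero] at this
    exact this.mono_left nhdsWithin_le_nhds
  obtain ⟨t, a, b, c, d⟩ := (k₁.and (k₂.and ((ht.eventually e₁).and (ht.eventually e₂)))).exists
  have := d.1 (c.2 a)
  linarith

theorem outwardNormal_eq {U : Set Plane} {x ν : Plane} (h : IsOutwardUnitNormal U x ν) :
    outwardNormal U x = ν := by
  have hex : ∃ ν, IsOutwardUnitNormal U x ν := ⟨ν, h⟩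
  rw [outwardNormal, dif_pos hex]
  exact hex.choose_spec.eq h

theorem inner_ellipseGrad_self {l r : ℝ} (x : Plane) :
    inner ℝ (ellipseGrad l r x) x = 2 * (ellipseForm l r x + 1) := by
  simp only [ellipseForm, ellipseGrad, inner_plane, Matrix.cons_val_zero,
    Matrix.cons_val_one]
  ring

theorem inner_self_ellipseGrad_pos {l r : ℝ} {x : Plane} (hx : ellipseForm l r x = 0) :
    0 < inner ℝ x (ellipseGrad l r x) := by
  rw [real_inner_comm, inner_ellipseGrad_self, hx]
  norm_num

theorem ellipseGrad_ne_zero {l r : ℝ} {x : Plane} (hx : ellipseForm l r x = 0) :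
    ellipseGrad l r x ≠ 0 := by
  intro h
  have := inner_self_ellipseGrad_pos hx
  rw [h, inner_zero_right] at this
  exact this.false

theorem outwardNormal_ellipse {l r : ℝ} (hl : 0 < l) (hr : 0 < r) {x : Plane}
    (hx : ellipseForm l r x = 0) :
    outwardNormal (ellipse l r) x = ‖ellipseGrad l r x‖⁻¹ • ellipseGrad l r x := by
  have hn : 0 < ‖ellipseGrad l r x‖ := norm_pos_iff.2 (ellipseGrad_ne_zero hx)
  refine outwardNormal_eq ⟨?_, ellipseForm l r, (contDiff_ellipseForm l r).contDiffAt, hx,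
    ⟨‖ellipseGrad l r x‖, hn, ?_⟩, Eventually.of_forall fun y => mem_ellipse_iff hl hr y⟩
  · rw [norm_smul, norm_inv, norm_norm, inv_mul_cancel₀ hn.ne']
  · rw [gradient_ellipseForm, smul_smul, mul_inv_cancel₀ hn.ne', one_smul]

theorem inner_self_outwardNormal_pos {l r : ℝ} (hl : 0 < l) (hr : 0 < r) {x : Plane}
    (hx : ellipseForm l r x = 0) : 0 < inner ℝ x (outwardNormal (ellipse l r) x) := by
  rw [outwardNormal_ellipse hl hr hx, real_inner_smul_right]
  exact mul_pos (inv_pos.2 (norm_pos_iff.2 (ellipseGrad_ne_zero hx))) (inner_self_ellipseGrad_pos hx)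

theorem inner_ellipseGrad_outwardNormal_pos {l r : ℝ} (hl : 0 < l) (hr : 0 < r) {x : Plane}
    (hx : ellipseForm l r x = 0) :
    0 < inner ℝ (ellipseGrad l r x) (outwardNormal (ellipse l r) x) := by
  have h := norm_pos_iff.2 (ellipseGrad_ne_zero hx)
  rw [outwardNormal_ellipse hl hr hx, real_inner_smul_right, real_inner_self_eq_norm_sq]
  positivity

theorem ellipseForm_add_outwardNormal_pos {l r : ℝ} (hl : 0 < l) (hr : 0 < r) {x : Plane}
    (hx : ellipseForm l r x = 0) {t : ℝ} (ht : 0 < t) :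
    0 < ellipseForm l r (x + t • outwardNormal (ellipse l r) x) := by
  rw [ellipseForm_add_smul, hx, zero_add]
  exact add_pos_of_pos_of_nonneg (mul_pos ht (inner_ellipseGrad_outwardNormal_pos hl hr hx))
    (mul_nonneg (sq_nonneg t) (ellipseForm_add_one_nonneg l r _))

theorem ellipseForm_sub_outwardNormal_neg {l r : ℝ} (hl : 0 < l) (hr : 0 < r) {x : Plane}
    (hx : ellipseForm l r x = 0) :
    ∀ᶠ t in 𝓝[>] (0 : ℝ), ellipseForm l r (x - t • outwardNormal (ellipse l r) x) < 0 := by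
  have h := eventually_neg_of_hasGradientAt (v := -outwardNormal (ellipse l r) x)
    ((contDiff_ellipseForm l r (k := 1)).differentiable one_ne_zero x) hx (by
      rw [gradient_ellipseForm, inner_neg_right]
      exact neg_neg_of_pos (inner_ellipseGrad_outwardNormal_pos hl hr hx))
  simpa [smul_neg, sub_eq_add_neg] using h

theorem ellipseForm_lt_of_lt {l r s : ℝ} (hl : 0 < l) (hr : 0 < r) (hrs : r < s) {x : Plane}
    (hx : ellipseForm l r x ≤ 0) : ellipseForm l s x < 0 := by
  obtain ⟨⟨ξ, η⟩, h0, -, -, rfl⟩ := exists_ellipticCoords hl x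
  refine ellipseForm_ellipticPoint_neg hl (hr.trans hrs) h0 ?_ η
  by_contra! hc
  exact hx.not_gt (ellipseForm_ellipticPoint_pos hl hr (hrs.trans_le hc) η)

/-! ### The Laplacian and restriction to lines -/

theorem hasDerivAt_line (x v : Plane) (t : ℝ) : HasDerivAt (fun t : ℝ => x + t • v) v t := by
  simpa using ((hasDerivAt_id t).smul_const v).const_add x

theorem hasDerivAt_comp_line {f : Plane → ℝ} {x v : Plane} {t : ℝ}
    (h : DifferentiableAt ℝ f (x + t • v)) :
    HasDerivAt (fun t : ℝ => f (x + t • v)) (inner ℝ (∇ f (x + t • v)) v) t := by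
  rw [inner_gradient_left]
  exact h.hasFDerivAt.comp_hasDerivAt t (hasDerivAt_line x v t)

theorem tendsto_line (x v : Plane) : Tendsto (fun t : ℝ => x + t • v) (𝓝 0) (𝓝 x) := by
  have h := (hasDerivAt_line x v 0).continuousAt.tendsto
  simpa using h

theorem iteratedFDeriv_two_eq_deriv_deriv {f : Plane → ℝ} {x : Plane} (h : ContDiffAt ℝ 2 f x)
    (v : Plane) :
    iteratedFDeriv ℝ 2 f x ![v, v] = deriv (deriv fun t : ℝ => f (x + t • v)) 0 := by
  have h1 : ∀ᶠ t in 𝓝 (0 : ℝ), DifferentiableAt ℝ f (x + t • v) :=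
    (tendsto_line x v).eventually ((h.eventually (by simp)).mono fun y hy =>
      hy.differentiableAt two_ne_zero)
  have h2 : (deriv fun t : ℝ => f (x + t • v)) =ᶠ[𝓝 0] fun t => fderiv ℝ f (x + t • v) v := by
    filter_upwards [h1] with t ht
    exact (ht.hasFDerivAt.comp_hasDerivAt t (hasDerivAt_line x v t)).deriv
  rw [h2.deriv_eq, iteratedFDeriv_two_apply]
  have h3 : DifferentiableAt ℝ (fderiv ℝ f) (x + (0 : ℝ) • v) := by
    simpa using (h.fderiv_right (m := 1) le_rfl).differentiableAt one_ne_zero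
  have h4 : HasDerivAt (fun t : ℝ => fderiv ℝ f (x + t • v))
      (fderiv ℝ (fderiv ℝ f) (x + (0 : ℝ) • v) v) 0 :=
    HasFDerivAt.comp_hasDerivAt (l := fderiv ℝ f) (0 : ℝ) h3.hasFDerivAt (hasDerivAt_line x v 0)
  have h5 : HasDerivAt (fun t : ℝ => fderiv ℝ f (x + t • v) v)
      (fderiv ℝ (fderiv ℝ f) (x + (0 : ℝ) • v) v v) 0 :=
    ((ContinuousLinearMap.apply ℝ ℝ v).hasFDerivAt.comp_hasDerivAt (0 : ℝ) h4 :)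
  rw [h5.deriv]
  simp

/-- If the second derivative were positive, the second derivative test would make `a` a local
minimum too; then `f` is locally constant and its second derivative is zero. -/
theorem deriv_deriv_nonpos_of_isLocalMax {f : ℝ → ℝ} {a : ℝ} (h : IsLocalMax f a)
    (hc : ContinuousAt f a) : deriv (deriv f) a ≤ 0 := by
  by_contra! hpos
  have h1 := isLocalMin_of_deriv_deriv_pos hpos h.deriv_eq_zero hc
  have h2 : f =ᶠ[𝓝 a] fun _ => f a := by
    filter_upwards [h, h1] with y hy hy'
    exact le_antisymm hy hy'
  have h3 : deriv f =ᶠ[𝓝 a] fun _ => 0 := by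
    filter_upwards [h2.deriv] with y hy
    simpa using hy
  rw [h3.deriv_eq, deriv_const] at hpos
  exact hpos.false

theorem laplacian_eq_sum_deriv_deriv {f : Plane → ℝ} {x : Plane} (h : ContDiffAt ℝ 2 f x) :
    Δ f x = ∑ i, deriv (deriv fun t : ℝ => f (x + t • EuclideanSpace.basisFun (Fin 2) ℝ i)) 0 := by
  rw [laplacian_eq_iteratedFDeriv_orthonormalBasis f (EuclideanSpace.basisFun (Fin 2) ℝ)]
  exact Finset.sum_congr rfl fun i _ => iteratedFDeriv_two_eq_deriv_deriv h _

theorem laplacian_nonpos_of_isLocalMax {f : Plane → ℝ} {x : Plane} (h : ContDiffAt ℝ 2 f x)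
    (hm : IsLocalMax f x) : Δ f x ≤ 0 := by
  rw [laplacian_eq_sum_deriv_deriv h]
  refine Finset.sum_nonpos fun i _ => ?_
  set v := EuclideanSpace.basisFun (Fin 2) ℝ i
  refine deriv_deriv_nonpos_of_isLocalMax ?_ ?_
  · have := (tendsto_line x v).eventually hm
    simpa [IsLocalMax, IsMaxFilter] using this
  · have h' : ContinuousAt f (x + (0 : ℝ) • v) := by simpa using h.continuousAt
    exact ContinuousAt.comp (g := f) h' (hasDerivAt_line x v 0).continuousAt

theorem deriv_deriv_quadratic (a b c : ℝ) : deriv (deriv fun t : ℝ => a + t * b + t ^ 2 * c) 0 =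
    2 * c := by
  have h : (deriv fun t : ℝ => a + t * b + t ^ 2 * c) = fun t => b + t * (2 * c) := by
    funext t
    have := (((hasDerivAt_id t).mul_const b).const_add a).fun_add
      (((hasDerivAt_id t).fun_pow 2).mul_const c)
    refine (this.congr_deriv ?_).deriv
    simp
    ring
  rw [h]
  simp

/-! ### Quadratic barriers and strict subharmonicity -/

/-- The barrier `|x|² + c ρ(x)`, where `ρ` is the defining polynomial of an ellipse. -/
noncomputable def barrier (l r c : ℝ) (x : Plane) : ℝ := ‖x‖ ^ 2 + c * ellipseForm l r x

theorem contDiff_barrier (l r c : ℝ) {k : WithTop ℕ∞} : ContDiff ℝ k (barrier l r c) :=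
  (contDiff_norm_sq ℝ).add (contDiff_const.mul (contDiff_ellipseForm l r))

theorem barrier_line (l r c : ℝ) (x v : Plane) (t : ℝ) :
    barrier l r c (x + t • v) = barrier l r c x +
      t * (2 * inner ℝ x v + c * inner ℝ (ellipseGrad l r x) v) +
      t ^ 2 * (‖v‖ ^ 2 + c * (ellipseForm l r v + 1)) := by
  rw [barrier, ellipseForm_add_smul, norm_add_sq_real, real_inner_smul_right, norm_smul, mul_pow,
    Real.norm_eq_abs, sq_abs, barrier]
  ring

theorem laplacian_barrier_pos (l r : ℝ) {c : ℝ} (hc : 0 ≤ c) (x : Plane) :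
    0 < Δ (barrier l r c) x := by
  rw [laplacian_eq_sum_deriv_deriv (contDiff_barrier l r c).contDiffAt]
  refine Finset.sum_pos (fun i _ => ?_) Finset.univ_nonempty
  simp only [barrier_line, deriv_deriv_quadratic, OrthonormalBasis.norm_eq_one]
  have := mul_nonneg hc (ellipseForm_add_one_nonneg l r (EuclideanSpace.basisFun (Fin 2) ℝ i))
  linarith

theorem hasDerivAt_barrier_line (l r c : ℝ) (x v : Plane) :
    HasDerivAt (fun t : ℝ => barrier l r c (x + t • v))
      (2 * inner ℝ x v + c * inner ℝ (ellipseGrad l r x) v) 0 := by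
  simp only [barrier_line]
  refine (((hasDerivAt_id (0 : ℝ)).mul_const
    (2 * inner ℝ x v + c * inner ℝ (ellipseGrad l r x) v)).const_add (barrier l r c x)).fun_add
    (((hasDerivAt_id (0 : ℝ)).fun_pow 2).mul_const (‖v‖ ^ 2 + c * (ellipseForm l r v + 1)))
    |>.congr_deriv ?_
  simp

theorem not_isLocalMax_harmonic_add_barrier {w : Plane → ℝ} {x : Plane} (hw : HarmonicAt w x)
    (l r : ℝ) {c ε : ℝ} (hc : 0 ≤ c) (hε : 0 < ε) :
    ¬ IsLocalMax (w + ε • barrier l r c) x := by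
  intro hm
  have hb : ContDiffAt ℝ 2 (barrier l r c) x := (contDiff_barrier l r c).contDiffAt
  have hb' : ContDiffAt ℝ 2 (ε • barrier l r c) x := hb.const_smul ε
  have h : Δ (w + ε • barrier l r c) x ≤ 0 :=
    laplacian_nonpos_of_isLocalMax (hw.1.add hb') hm
  rw [hw.1.laplacian_add hb', laplacian_smul _ hb, hw.2.self_of_nhds, smul_eq_mul] at h
  have := mul_pos hε (laplacian_barrier_pos l r hc x)
  simp only [Pi.zero_apply, zero_add] at h
  linarith

/-! ### One-sided derivatives along a normal -/

theorem nonpos_of_hasDerivWithinAt_of_le {h : ℝ → ℝ} {a : ℝ}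
    (hd : HasDerivWithinAt h a (Set.Ici 0) 0) (hm : ∀ᶠ t in 𝓝[>] (0 : ℝ), h t ≤ h 0) : a ≤ 0 := by
  have hs := (hasDerivWithinAt_iff_tendsto_slope' Set.self_notMem_Ioi).1
    (hd.mono Set.Ioi_subset_Ici_self)
  refine le_of_tendsto hs ?_
  filter_upwards [hm, self_mem_nhdsWithin] with t h1 h2
  rw [slope_def_field]
  exact div_nonpos_of_nonpos_of_nonneg (by linarith) (by simpa using (Set.mem_Ioi.1 h2).le)

/-- The system only prescribes limits of gradients along normals. By the mean value theorem,
continuity at the endpoint turns such a limit into a one-sided derivative at the boundary point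
itself, which can be tested against a maximum. -/
theorem hasDerivWithinAt_line_of_tendsto {f : Plane → ℝ} {x v : Plane} {a : ℝ}
    (hd : ∀ᶠ t in 𝓝[>] (0 : ℝ), DifferentiableAt ℝ f (x + t • v))
    (hc : Tendsto (fun t : ℝ => f (x + t • v)) (𝓝[>] 0) (𝓝 (f x)))
    (ha : Tendsto (fun t : ℝ => inner ℝ (∇ f (x + t • v)) v) (𝓝[>] 0) (𝓝 a)) :
    HasDerivWithinAt (fun t : ℝ => f (x + t • v)) a (Set.Ici 0) 0 := by
  refine hasDerivWithinAt_Ici_of_tendsto_deriv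
    (s := {t | 0 < t ∧ DifferentiableAt ℝ f (x + t • v)}) ?_ ?_ ?_ ?_
  · exact fun t ht => (hasDerivAt_comp_line ht.2).differentiableAt.differentiableWithinAt
  · have : ContinuousWithinAt (fun t : ℝ => f (x + t • v)) (Set.Ioi 0) 0 := by
      simpa [ContinuousWithinAt] using hc
    exact this.mono fun t ht => ht.1
  · filter_upwards [hd, self_mem_nhdsWithin] with t h1 h2 using ⟨h2, h1⟩
  · refine ha.congr' ?_
    filter_upwards [hd] with t ht
    exact (hasDerivAt_comp_line ht).deriv.symm

/-- At a boundary maximum of `w + ε |x|² + ε c ρ` along a ray, the derivative along the ray is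
nonpositive. -/
theorem ray_deriv_nonpos {w : Plane → ℝ} {x v : Plane} {a l r c ε : ℝ}
    (hd : ∀ᶠ t in 𝓝[>] (0 : ℝ), DifferentiableAt ℝ w (x + t • v))
    (hc : Tendsto (fun t : ℝ => w (x + t • v)) (𝓝[>] 0) (𝓝 (w x)))
    (ha : Tendsto (fun t : ℝ => inner ℝ (∇ w (x + t • v)) v) (𝓝[>] 0) (𝓝 a))
    (hm : ∀ᶠ t in 𝓝[>] (0 : ℝ), w (x + t • v) + ε * barrier l r c (x + t • v) ≤
      w x + ε * barrier l r c x) :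
    a + ε * (2 * inner ℝ x v + c * inner ℝ (ellipseGrad l r x) v) ≤ 0 := by
  refine nonpos_of_hasDerivWithinAt_of_le ((hasDerivWithinAt_line_of_tendsto hd hc ha).fun_add
    ((hasDerivAt_barrier_line l r c x v).hasDerivWithinAt.const_mul ε)) ?_
  simpa using hm

/-! ### The maximum principle for the exterior Neumann problem with an interface -/

/-- The barrier `|x|² + max(0, ρ(x))`, with a convex kink across the ellipse of radius `r`. -/
noncomputable def kinkBarrier (l r : ℝ) (x : Plane) : ℝ := ‖x‖ ^ 2 + max 0 (ellipseForm l r x)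

theorem kinkBarrier_of_nonpos {l r : ℝ} {x : Plane} (h : ellipseForm l r x ≤ 0) :
    kinkBarrier l r x = barrier l r 0 x := by
  rw [kinkBarrier, barrier, max_eq_left h, zero_mul]

theorem kinkBarrier_of_nonneg {l r : ℝ} {x : Plane} (h : 0 ≤ ellipseForm l r x) :
    kinkBarrier l r x = barrier l r 1 x := by
  rw [kinkBarrier, barrier, max_eq_right h, one_mul]

theorem continuous_kinkBarrier (l r : ℝ) : Continuous (kinkBarrier l r) :=
  (continuous_norm.pow 2).add ((continuous_const (y := (0 : ℝ))).max (continuous_ellipseForm l r))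

theorem mem_exterior_iff {l r : ℝ} (hl : 0 < l) (hr : 0 < r) (x : Plane) :
    x ∈ (ellipse l r)ᶜ ↔ 0 ≤ ellipseForm l r x := by
  rw [Set.mem_compl_iff, mem_ellipse_iff hl hr, not_lt]

theorem mem_compl_closure_ellipse {l r : ℝ} (hl : 0 < l) (hr : 0 < r) (x : Plane) :
    x ∈ (closure (ellipse l r))ᶜ ↔ 0 < ellipseForm l r x := by
  rw [closure_ellipse hl hr]
  exact not_le (α := ℝ)

theorem mem_frontier_ellipse {l r : ℝ} (hl : 0 < l) (hr : 0 < r) (x : Plane) :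
    x ∈ frontier (ellipse l r) ↔ ellipseForm l r x = 0 := by
  rw [frontier_ellipse hl hr]
  exact Iff.rfl

theorem tendsto_line_right (x v : Plane) :
    Tendsto (fun t : ℝ => x + t • v) (𝓝[>] 0) (𝓝 x) :=
  (tendsto_line x v).mono_left nhdsWithin_le_nhds

/-- The heart of uniqueness, a Hopf-type argument made elementary by the barrier. The kink is
essential: with a smooth barrier the two one-sided inequalities at `∂Ω` would only add up to `0 ≤
0`. -/
theorem not_isMax_add_kinkBarrier {l ξi ξe : ℝ} (hl : 0 < l) (hi : 0 < ξi) (hie : ξi < ξe)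
    {w : Plane → ℝ} (hc : ContinuousOn w (ellipse l ξi)ᶜ)
    (hh : HarmonicOnNhd w ((closure (ellipse l ξi))ᶜ \ frontier (ellipse l ξe)))
    (hn : ∀ x ∈ frontier (ellipse l ξi), HasOuterNormalDeriv (ellipse l ξi) w x 0)
    (hj : ∀ x ∈ frontier (ellipse l ξe), ∃ a, HasOuterNormalDeriv (ellipse l ξe) w x a ∧
      HasInnerNormalDeriv (ellipse l ξe) w x a)
    {ε : ℝ} (hε : 0 < ε) {x : Plane} (hx : x ∈ (ellipse l ξi)ᶜ) :
    ¬ ∀ᶠ y in 𝓝[(ellipse l ξi)ᶜ] x,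
      w y + ε * kinkBarrier l ξe y ≤ w x + ε * kinkBarrier l ξe x := by
  intro hm
  have he := hi.trans hie
  have hx0 := (mem_exterior_iff hl hi x).1 hx
  have hopen : ∀ r : ℝ, IsOpen {y | 0 < ellipseForm l r y} := fun r =>
    isOpen_lt continuous_const (continuous_ellipseForm l r)
  have hopen' : IsOpen {y | ellipseForm l ξe y < 0} :=
    isOpen_lt (continuous_ellipseForm l ξe) continuous_const
  have hdiff : ∀ y, 0 < ellipseForm l ξi y → ellipseForm l ξe y ≠ 0 → DifferentiableAt ℝ w y :=
    fun y h1 h2 => (hh y ⟨(mem_compl_closure_ellipse hl hi y).2 h1, fun h =>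
      h2 ((mem_frontier_ellipse hl he y).1 h)⟩).1.differentiableAt two_ne_zero
  have hray : ∀ v : Plane, (∀ᶠ t in 𝓝[>] (0 : ℝ), x + t • v ∈ (ellipse l ξi)ᶜ) →
      Tendsto (fun t : ℝ => x + t • v) (𝓝[>] 0) (𝓝[(ellipse l ξi)ᶜ] x) := fun v hv =>
    tendsto_nhdsWithin_iff.2 ⟨tendsto_line_right x v, hv⟩
  rcases hx0.eq_or_lt with hx0 | hx0
  -- On `∂D` the normal derivative of `w` is 0 while that of `|x|²` is `2⟨x, ν⟩ > 0`.
  · have hx0 := hx0.symm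
    set ν := outwardNormal (ellipse l ξi) x with hν
    have hρ : ∀ᶠ t in 𝓝[>] (0 : ℝ), 0 < ellipseForm l ξi (x + t • ν) := by
      filter_upwards [self_mem_nhdsWithin] with t ht
      exact ellipseForm_add_outwardNormal_pos hl hi hx0 ht
    have hin : ∀ᶠ t in 𝓝[>] (0 : ℝ), ellipseForm l ξe (x + t • ν) < 0 :=
      (tendsto_line_right x ν).eventually
        (hopen'.mem_nhds (ellipseForm_lt_of_lt hl hi hie hx0.le))
    have hr := hray ν (hρ.mono fun t ht => (mem_exterior_iff hl hi _).2 ht.le)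
    have h := ray_deriv_nonpos (l := l) (r := ξe) (c := 0) (ε := ε) (w := w) (x := x) (v := ν)
      (a := 0) (by filter_upwards [hρ, hin] with t h1 h2 using hdiff _ h1 h2.ne)
      ((hc x hx).tendsto.comp hr) (hn x ((mem_frontier_ellipse hl hi x).2 hx0)) (by
        filter_upwards [hr.eventually hm, hin] with t h1 h2
        rwa [kinkBarrier_of_nonpos h2.le,
          kinkBarrier_of_nonpos (ellipseForm_lt_of_lt hl hi hie hx0.le).le] at h1)
    have := mul_pos hε (inner_self_outwardNormal_pos hl hi hx0)
    rw [← hν] at this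
    linarith
  have hm' : ∀ᶠ y in 𝓝 x, w y + ε * kinkBarrier l ξe y ≤ w x + ε * kinkBarrier l ξe x := by
    have : (ellipse l ξi)ᶜ ∈ 𝓝 x := mem_of_superset ((hopen ξi).mem_nhds hx0)
      fun y hy => (mem_exterior_iff hl hi y).2 (le_of_lt hy)
    rwa [nhdsWithin_eq_nhds.2 this] at hm
  have hcx : ContinuousAt w x := by
    refine hc.continuousAt (mem_of_superset ((hopen ξi).mem_nhds hx0)
      fun y hy => (mem_exterior_iff hl hi y).2 (le_of_lt hy))
  have hharm : ellipseForm l ξe x ≠ 0 → HarmonicAt w x := fun h2 =>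
    hh x ⟨(mem_compl_closure_ellipse hl hi x).2 hx0, fun h =>
      h2 ((mem_frontier_ellipse hl he x).1 h)⟩
  rcases lt_trichotomy (ellipseForm l ξe x) 0 with h | h | h
  · refine not_isLocalMax_harmonic_add_barrier (hharm h.ne) l ξe le_rfl hε ?_
    filter_upwards [hm', hopen'.mem_nhds h] with y hy hy'
    rw [kinkBarrier_of_nonpos (le_of_lt hy'), kinkBarrier_of_nonpos h.le] at hy
    exact hy
  -- On `∂Ω` the inequalities along `ν` and `-ν` are added: `±a` and the `|x|²` terms cancel,
  -- leaving the positive slope of the kink.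
  · obtain ⟨a, ha, hb⟩ := hj x ((mem_frontier_ellipse hl he x).2 h)
    unfold HasOuterNormalDeriv at ha
    unfold HasInnerNormalDeriv at hb
    set ν := outwardNormal (ellipse l ξe) x with hν
    have hi' : ∀ v : Plane, ∀ᶠ t in 𝓝[>] (0 : ℝ), 0 < ellipseForm l ξi (x + t • v) := fun v =>
      (tendsto_line_right x v).eventually ((hopen ξi).mem_nhds hx0)
    have hout : ∀ᶠ t in 𝓝[>] (0 : ℝ), 0 < ellipseForm l ξe (x + t • ν) := by
      filter_upwards [self_mem_nhdsWithin] with t ht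
      exact ellipseForm_add_outwardNormal_pos hl he h ht
    have hin : ∀ᶠ t in 𝓝[>] (0 : ℝ), ellipseForm l ξe (x + t • (-ν)) < 0 := by
      simpa [smul_neg, ← sub_eq_add_neg] using ellipseForm_sub_outwardNormal_neg hl he h
    have h1 := ray_deriv_nonpos (l := l) (r := ξe) (c := 1) (ε := ε) (w := w) (x := x) (v := ν)
      (a := a) (by filter_upwards [hi' ν, hout] with t h1 h2 using hdiff _ h1 h2.ne')
      (hcx.tendsto.comp (tendsto_line_right x ν)) ha (by
        filter_upwards [(tendsto_line_right x ν).eventually hm', hout] with t h1 h2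
        rwa [kinkBarrier_of_nonneg h2.le, kinkBarrier_of_nonneg h.ge] at h1)
    have h2 := ray_deriv_nonpos (l := l) (r := ξe) (c := 0) (ε := ε) (w := w) (x := x) (v := -ν)
      (a := -a) (by filter_upwards [hi' (-ν), hin] with t h1 h2 using hdiff _ h1 h2.ne)
      (hcx.tendsto.comp (tendsto_line_right x (-ν))) (by
        simpa [smul_neg, ← sub_eq_add_neg, inner_neg_right] using hb.neg) (by
        filter_upwards [(tendsto_line_right x (-ν)).eventually hm', hin] with t h1 h2
        rwa [kinkBarrier_of_nonpos h2.le, kinkBarrier_of_nonpos h.le] at h1)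
    have := mul_pos hε (inner_ellipseGrad_outwardNormal_pos hl he h)
    rw [← hν] at this
    rw [inner_neg_right] at h2
    linarith
  · refine not_isLocalMax_harmonic_add_barrier (hharm h.ne') l ξe zero_le_one hε ?_
    filter_upwards [hm', (hopen ξe).mem_nhds h] with y hy hy'
    rw [kinkBarrier_of_nonneg (le_of_lt hy'), kinkBarrier_of_nonneg h.le] at hy
    exact hy

theorem nonpos_of_neumann_of_interface {l ξi ξe : ℝ} (hl : 0 < l) (hi : 0 < ξi) (hie : ξi < ξe)
    {w : Plane → ℝ} (hc : ContinuousOn w (ellipse l ξi)ᶜ)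
    (hh : HarmonicOnNhd w ((closure (ellipse l ξi))ᶜ \ frontier (ellipse l ξe)))
    (hn : ∀ x ∈ frontier (ellipse l ξi), HasOuterNormalDeriv (ellipse l ξi) w x 0)
    (hj : ∀ x ∈ frontier (ellipse l ξe), ∃ a, HasOuterNormalDeriv (ellipse l ξe) w x a ∧
      HasInnerNormalDeriv (ellipse l ξe) w x a)
    (hO : Tendsto w (Bornology.cobounded Plane) (𝓝 0)) {x : Plane}
    (hx : x ∈ (ellipse l ξi)ᶜ) : w x ≤ 0 := by
  refine le_of_forall_pos_le_add fun δ hδ => ?_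
  obtain ⟨R₀, -, hR₀⟩ := (hasBasis_cobounded_norm (E := Plane)).eventually_iff.1
    (hO.eventually (gt_mem_nhds (half_pos hδ)))
  set R := max R₀ ‖x‖ with hR
  have hK : IsCompact (Metric.closedBall (0 : Plane) R ∩ (ellipse l ξi)ᶜ) :=
    (isCompact_closedBall _ _).inter_right (isOpen_ellipse hl hi).isClosed_compl
  have hxK : x ∈ Metric.closedBall (0 : Plane) R ∩ (ellipse l ξi)ᶜ :=
    ⟨by simp [hR], hx⟩
  have hg := continuous_kinkBarrier l ξe
  obtain ⟨z, hz, hzm⟩ := hK.exists_isMaxOn ⟨x, hxK⟩ hg.continuousOn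
  have hg0 : ∀ y, 0 ≤ kinkBarrier l ξe y := fun y =>
    add_nonneg (sq_nonneg _) (le_max_left _ _)
  set G := kinkBarrier l ξe z with hG
  have hG0 : 0 ≤ G := hg0 z
  -- `G` is the maximum of the barrier on the compact set; `+ 1` keeps the denominator positive.
  set ε := δ / 2 / (G + 1) with hε
  have hε0 : 0 < ε := by positivity
  have hεG : ε * G ≤ δ / 2 := by
    rw [hε, div_mul_eq_mul_div, div_le_iff₀ (by positivity)]
    nlinarith
  obtain ⟨m, hmK, hmm⟩ := hK.exists_isMaxOn ⟨x, hxK⟩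
    ((hc.mono Set.inter_subset_right).add (hg.continuousOn.const_smul ε))
  -- A maximum inside the open ball is excluded by the barrier, so it lies on the outer circle,
  -- where `w < δ / 2`.
  have hmR : R ≤ ‖m‖ := by
    by_contra! hlt
    refine not_isMax_add_kinkBarrier hl hi hie hc hh hn hj hε0 hmK.2 ?_
    rw [eventually_nhdsWithin_iff]
    filter_upwards [Metric.isOpen_ball.mem_nhds (mem_ball_zero_iff.2 hlt)] with y hy hy'
    exact hmm ⟨Metric.ball_subset_closedBall hy, hy'⟩
  have h1 : w x + ε * kinkBarrier l ξe x ≤ w m + ε * kinkBarrier l ξe m := hmm hxK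
  have h2 : w m < δ / 2 := hR₀ ((le_max_left _ _).trans hmR)
  have h3 : ε * kinkBarrier l ξe m ≤ ε * G := mul_le_mul_of_nonneg_left (hzm hmK) hε0.le
  have h4 : 0 ≤ ε * kinkBarrier l ξe x := mul_nonneg hε0.le (hg0 x)
  linarith

theorem HasOuterNormalDeriv.neg {U : Set Plane} {f : Plane → ℝ} {x : Plane} {a : ℝ}
    (h : HasOuterNormalDeriv U f x a) : HasOuterNormalDeriv U (-f) x (-a) := by
  unfold HasOuterNormalDeriv at h ⊢
  simpa [inner_gradient_left, fderiv_neg] using h.neg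

theorem HasInnerNormalDeriv.neg {U : Set Plane} {f : Plane → ℝ} {x : Plane} {a : ℝ}
    (h : HasInnerNormalDeriv U f x a) : HasInnerNormalDeriv U (-f) x (-a) := by
  unfold HasInnerNormalDeriv at h ⊢
  simpa [inner_gradient_left, fderiv_neg] using h.neg

/-- Uniqueness for the exterior Neumann problem with an interface. -/
theorem eq_zero_of_neumann_of_interface {l ξi ξe : ℝ} (hl : 0 < l) (hi : 0 < ξi) (hie : ξi < ξe)
    {w : Plane → ℝ} (hc : ContinuousOn w (ellipse l ξi)ᶜ)
    (hh : HarmonicOnNhd w ((closure (ellipse l ξi))ᶜ \ frontier (ellipse l ξe)))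
    (hn : ∀ x ∈ frontier (ellipse l ξi), HasOuterNormalDeriv (ellipse l ξi) w x 0)
    (hj : ∀ x ∈ frontier (ellipse l ξe), ∃ a, HasOuterNormalDeriv (ellipse l ξe) w x a ∧
      HasInnerNormalDeriv (ellipse l ξe) w x a)
    (hO : Tendsto w (Bornology.cobounded Plane) (𝓝 0)) {x : Plane}
    (hx : x ∈ (ellipse l ξi)ᶜ) : w x = 0 := by
  refine le_antisymm (nonpos_of_neumann_of_interface hl hi hie hc hh hn hj hO hx) ?_
  have h := nonpos_of_neumann_of_interface hl hi hie (w := -w) hc.neg hh.neg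
    (fun x hx => by simpa using (hn x hx).neg)
    (fun x hx => by
      obtain ⟨a, ha, hb⟩ := hj x hx
      exact ⟨-a, ha.neg, hb.neg⟩)
    (by simpa [Pi.neg_def] using hO.neg) hx
  simpa using h

/-! ### Uniqueness of the solution of the system -/

theorem HasOuterNormalDeriv.sub {U : Set Plane} {f g : Plane → ℝ} {x : Plane} {a b : ℝ}
    (hf : HasOuterNormalDeriv U f x a) (hg : HasOuterNormalDeriv U g x b)
    (hd : ∀ᶠ t in 𝓝[>] (0 : ℝ), DifferentiableAt ℝ f (x + t • outwardNormal U x) ∧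
      DifferentiableAt ℝ g (x + t • outwardNormal U x)) :
    HasOuterNormalDeriv U (f - g) x (a - b) := by
  refine (Tendsto.sub hf hg).congr' ?_
  filter_upwards [hd] with t ht
  simp only [inner_gradient_left, fderiv_sub ht.1 ht.2, sub_apply]

theorem HasInnerNormalDeriv.sub {U : Set Plane} {f g : Plane → ℝ} {x : Plane} {a b : ℝ}
    (hf : HasInnerNormalDeriv U f x a) (hg : HasInnerNormalDeriv U g x b)
    (hd : ∀ᶠ t in 𝓝[>] (0 : ℝ), DifferentiableAt ℝ f (x - t • outwardNormal U x) ∧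
      DifferentiableAt ℝ g (x - t • outwardNormal U x)) :
    HasInnerNormalDeriv U (f - g) x (a - b) := by
  refine (Tendsto.sub hf hg).congr' ?_
  filter_upwards [hd] with t ht
  simp only [inner_gradient_left, fderiv_sub ht.1 ht.2, sub_apply]

theorem tendsto_inner_gradient_line {f : Plane → ℝ} {x : Plane} (hf : ContDiffAt ℝ 2 f x)
    (v ν : Plane) :
    Tendsto (fun t : ℝ => inner ℝ (∇ f (x + t • v)) ν) (𝓝[>] 0) (𝓝 (inner ℝ (∇ f x) ν)) := by
  simp only [inner_gradient_left]
  have h : ContinuousAt (fderiv ℝ f) x :=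
    (hf.fderiv_right (m := 1) le_rfl).continuousAt
  exact (h.clm_apply continuousAt_const).tendsto.comp (tendsto_line_right x v)

theorem HasOuterNormalDeriv.of_contDiffAt {U : Set Plane} {f g : Plane → ℝ} {x : Plane}
    (hf : ContDiffAt ℝ 2 f x)
    (hg : ∀ᶠ t in 𝓝[>] (0 : ℝ), g =ᶠ[𝓝 (x + t • outwardNormal U x)] f) :
    HasOuterNormalDeriv U g x (inner ℝ (∇ f x) (outwardNormal U x)) := by
  refine (tendsto_inner_gradient_line hf (outwardNormal U x) _).congr' ?_
  filter_upwards [hg] with t ht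
  rw [ht.gradient_eq]

theorem HasInnerNormalDeriv.of_contDiffAt {U : Set Plane} {f g : Plane → ℝ} {x : Plane}
    (hf : ContDiffAt ℝ 2 f x)
    (hg : ∀ᶠ t in 𝓝[>] (0 : ℝ), g =ᶠ[𝓝 (x - t • outwardNormal U x)] f) :
    HasInnerNormalDeriv U g x (inner ℝ (∇ f x) (outwardNormal U x)) := by
  have h := tendsto_inner_gradient_line hf (-outwardNormal U x) (outwardNormal U x)
  simp only [smul_neg, ← sub_eq_add_neg] at h
  refine h.congr' ?_
  filter_upwards [hg] with t ht
  rw [ht.gradient_eq]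

theorem tendsto_zero_of_isBigO_inv_norm {f : Plane → ℝ}
    (h : f =O[Bornology.cobounded Plane] fun x => ‖x‖⁻¹) :
    Tendsto f (Bornology.cobounded Plane) (𝓝 0) :=
  h.trans_tendsto (tendsto_inv_atTop_zero.comp tendsto_norm_cobounded_atTop)

/-- The equation for `φ` is decoupled, so it is settled first. Equal `φ` gives equal jump data on
`∂Ω`, and then `p₁ - p₂` has no jump in its normal derivative. -/
theorem IsSolution.unique {l ξi ξe : ℝ} (hl : 0 < l) (hi : 0 < ξi) (hie : ξi < ξe)
    {ζ₀ : ℝ} {H P φ₁ p₁ φ₂ p₂ : Plane → ℝ}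
    (h₁ : IsSolution (ellipse l ξi) (ellipse l ξe) ζ₀ H P φ₁ p₁)
    (h₂ : IsSolution (ellipse l ξi) (ellipse l ξe) ζ₀ H P φ₂ p₂) {x : Plane}
    (hx : x ∈ (ellipse l ξi)ᶜ) : p₁ x = p₂ x := by
  have he := hi.trans hie
  have hdφ : ∀ {φ p : Plane → ℝ}, IsSolution (ellipse l ξi) (ellipse l ξe) ζ₀ H P φ p →
      ∀ y, 0 < ellipseForm l ξi y → DifferentiableAt ℝ φ y := fun h y hy =>
    (h.phi_harmonic y ((mem_compl_closure_ellipse hl hi y).2 hy)).1.differentiableAt two_ne_zero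
  have hdp : ∀ {φ p : Plane → ℝ}, IsSolution (ellipse l ξi) (ellipse l ξe) ζ₀ H P φ p →
      ∀ y, 0 < ellipseForm l ξi y → ellipseForm l ξe y ≠ 0 → DifferentiableAt ℝ p y :=
    fun h y hy hy' => (h.p_harmonic y ⟨(mem_compl_closure_ellipse hl hi y).2 hy, fun hf =>
      hy' ((mem_frontier_ellipse hl he y).1 hf)⟩).1.differentiableAt two_ne_zero
  have hi_of_frontier : ∀ y, ellipseForm l ξe y = 0 → 0 < ellipseForm l ξi y := fun y hy => by
    by_contra! hc
    exact (ellipseForm_lt_of_lt hl hi hie hc).ne hy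
  have hray : ∀ y, ellipseForm l ξi y = 0 → ∀ᶠ t in 𝓝[>] (0 : ℝ),
      0 < ellipseForm l ξi (y + t • outwardNormal (ellipse l ξi) y) ∧
      ellipseForm l ξe (y + t • outwardNormal (ellipse l ξi) y) ≠ 0 := fun y hy => by
    filter_upwards [self_mem_nhdsWithin, (tendsto_line_right y _).eventually
      ((isOpen_lt (continuous_ellipseForm l ξe) continuous_const).mem_nhds
        (ellipseForm_lt_of_lt hl hi hie hy.le))] with t ht h2
    exact ⟨ellipseForm_add_outwardNormal_pos hl hi hy ht, ne_of_lt h2⟩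
  have hnear : ∀ y, ellipseForm l ξe y = 0 → ∀ v : Plane,
      ∀ᶠ t in 𝓝[>] (0 : ℝ), 0 < ellipseForm l ξi (y + t • v) := fun y hy v =>
    (tendsto_line_right y v).eventually
      ((isOpen_lt continuous_const (continuous_ellipseForm l ξi)).mem_nhds (hi_of_frontier y hy))
  have hφ : ∀ y ∈ (ellipse l ξi)ᶜ, (φ₁ - φ₂) y = 0 := by
    intro y hy
    refine eq_zero_of_neumann_of_interface hl hi hie (h₁.phi_cont.sub h₂.phi_cont)
      ((h₁.phi_harmonic.sub h₂.phi_harmonic).mono Set.sdiff_subset) (fun y hy => ?_)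
      (fun y hy => ?_) (tendsto_zero_of_isBigO_inv_norm ?_) hy
    · have := (h₁.phi_neumann y hy).sub (h₂.phi_neumann y hy) (by
        filter_upwards [hray y ((mem_frontier_ellipse hl hi y).1 hy)] with t ht
        exact ⟨hdφ h₁ _ ht.1, hdφ h₂ _ ht.1⟩)
      simpa using this
    -- `φ₁ - φ₂` is smooth across `∂Ω`, so the interface condition holds trivially.
    · have hy' := hi_of_frontier y ((mem_frontier_ellipse hl he y).1 hy)
      have hC := ((h₁.phi_harmonic.sub h₂.phi_harmonic) y
        ((mem_compl_closure_ellipse hl hi y).2 hy')).1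
      exact ⟨_, .of_contDiffAt hC (Eventually.of_forall fun t => EventuallyEq.rfl),
        .of_contDiffAt hC (Eventually.of_forall fun t => EventuallyEq.rfl)⟩
    · refine (h₁.phi_infty.sub h₂.phi_infty).congr_left fun z => ?_
      simp
  have hgrad : ∀ y, 0 < ellipseForm l ξi y → ∇ φ₁ y = ∇ φ₂ y := fun y hy => by
    refine EventuallyEq.gradient_eq ?_
    filter_upwards [(isOpen_lt continuous_const (continuous_ellipseForm l ξi)).mem_nhds hy]
      with z hz
    exact sub_eq_zero.1 (hφ z ((mem_exterior_iff hl hi z).2 (le_of_lt hz)))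
  refine sub_eq_zero.1 (?_ : (p₁ - p₂) x = 0)
  refine eq_zero_of_neumann_of_interface hl hi hie (h₁.p_cont.sub h₂.p_cont)
    (h₁.p_harmonic.sub h₂.p_harmonic) (fun y hy => ?_)
    (fun y hy => ?_) (tendsto_zero_of_isBigO_inv_norm ?_) hx
  · have := (h₁.p_neumann y hy).sub (h₂.p_neumann y hy) (by
      filter_upwards [hray y ((mem_frontier_ellipse hl hi y).1 hy)] with t ht
      exact ⟨hdp h₁ _ ht.1 ht.2, hdp h₂ _ ht.1 ht.2⟩)
    simpa using this
  · have hy0 := (mem_frontier_ellipse hl he y).1 hy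
    obtain ⟨a₁, b₁, o₁, i₁, e₁⟩ := h₁.p_jump y hy
    obtain ⟨a₂, b₂, o₂, i₂, e₂⟩ := h₂.p_jump y hy
    rw [hgrad y (hi_of_frontier y hy0), ← e₂] at e₁
    refine ⟨a₁ - a₂, o₁.sub o₂ ?_, ?_⟩
    · filter_upwards [self_mem_nhdsWithin, hnear y hy0 (outwardNormal (ellipse l ξe) y)]
        with t ht h2
      have h3 := (ellipseForm_add_outwardNormal_pos hl he hy0 ht).ne'
      exact ⟨hdp h₁ _ h2 h3, hdp h₂ _ h2 h3⟩
    · have hi' := i₁.sub i₂ (by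
        filter_upwards [ellipseForm_sub_outwardNormal_neg hl he hy0,
          hnear y hy0 (-outwardNormal (ellipse l ξe) y)] with t h3 h2
        rw [smul_neg, ← sub_eq_add_neg] at h2
        exact ⟨hdp h₁ _ h2 h3.ne, hdp h₂ _ h2 h3.ne⟩)
      rwa [show b₁ - b₂ = a₁ - a₂ by linarith] at hi'
  · refine (h₁.p_infty.sub h₂.p_infty).congr_left fun z => ?_
    simp

/-! ### Harmonic functions of the plane from analytic functions -/

/-- The isometry of `ℂ` with the Euclidean plane. -/
noncomputable def toPlane : ℂ ≃ₗᵢ[ℝ] Plane := Complex.orthonormalBasisOneI.repr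

theorem toPlane_cosh (l ξ η : ℝ) :
    toPlane (l * Complex.cosh (ξ + η * Complex.I)) = ellipticPoint l ξ η := by
  have h := cosh_nat_mul 1 ξ η
  simp only [Nat.cast_one, one_mul] at h
  rw [h]
  ext i
  fin_cases i <;>
    simp [toPlane, Complex.orthonormalBasisOneI_repr_apply, ellipticPoint, mul_assoc]

/-- The Laplacian may be computed in any orthonormal basis, and an isometry carries one such basis
to another. -/
theorem laplacian_comp_toPlane_symm (f : ℂ → ℝ) (x : Plane) :
    Δ (f ∘ toPlane.symm) x = Δ f (toPlane.symm x) := by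
  rw [laplacian_eq_iteratedFDeriv_orthonormalBasis _ (Complex.orthonormalBasisOneI.map toPlane),
    laplacian_eq_iteratedFDeriv_orthonormalBasis _ Complex.orthonormalBasisOneI]
  refine Finset.sum_congr rfl fun i _ => ?_
  have h := toPlane.symm.toContinuousLinearEquiv.iteratedFDerivWithin_comp_right f
    uniqueDiffOn_univ (x := x) (Set.mem_univ _) 2
  simp only [Set.preimage_univ, iteratedFDerivWithin_univ] at h
  have h' : iteratedFDeriv ℝ 2 (f ∘ toPlane.symm) x =
    (iteratedFDeriv ℝ 2 f (toPlane.symm x)).compContinuousLinearMap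
      fun _ => (toPlane.symm.toContinuousLinearEquiv : Plane →L[ℝ] ℂ) := h
  rw [h', ContinuousMultilinearMap.compContinuousLinearMap_apply]
  congr 1
  funext j
  fin_cases j <;> simp

theorem harmonicAt_comp_toPlane_symm {f : ℂ → ℝ} {z : ℂ} (h : HarmonicAt f z) :
    HarmonicAt (f ∘ toPlane.symm) (toPlane z) := by
  have hz : toPlane.symm (toPlane z) = z := toPlane.symm_apply_apply z
  refine ⟨?_, ?_⟩
  · refine ContDiffAt.comp (toPlane z) ?_ toPlane.symm.contDiff.contDiffAt
    rw [hz]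
    exact h.1
  · have ht : Tendsto toPlane.symm (𝓝 (toPlane z)) (𝓝 z) := by
      simpa only [hz] using toPlane.symm.continuous.tendsto (toPlane z)
    filter_upwards [ht.eventually h.2] with x hx
    rw [laplacian_comp_toPlane_symm, hx]
    rfl

/-! ### Elliptic harmonics -/

/-- The analytic function whose real part is the elliptic harmonic. -/
noncomputable def analyticMode (n : ℕ) (θ A B : ℝ) (w : ℂ) : ℂ :=
  A * Complex.exp (n * w - θ * Complex.I) + B * Complex.exp (-(n * w - θ * Complex.I))

theorem analyticMode_re (n : ℕ) (θ A B ξ η : ℝ) :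
    (analyticMode n θ A B (ξ + η * Complex.I)).re =
      (A * Real.exp (n * ξ) + B * Real.exp (-(n * ξ))) * Real.cos (n * η - θ) := by
  have h : (n * (ξ + η * Complex.I) - θ * Complex.I : ℂ) =
      ((n * ξ : ℝ) : ℂ) + ((n * η - θ : ℝ) : ℂ) * Complex.I := by
    push_cast
    ring
  have h' : -((n * (ξ + η * Complex.I) - θ * Complex.I : ℂ)) =
      ((-(n * ξ) : ℝ) : ℂ) + ((-(n * η - θ) : ℝ) : ℂ) * Complex.I := by
    push_cast
    ring
  rw [analyticMode, h', h, Complex.add_re, Complex.re_ofReal_mul, Complex.re_ofReal_mul,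
    Complex.exp_re, Complex.exp_re]
  simp only [Complex.add_re, Complex.add_im, Complex.re_ofReal_mul, Complex.im_ofReal_mul,
    Complex.I_re, Complex.I_im, Complex.ofReal_re, Complex.ofReal_im, mul_zero, mul_one, zero_add,
    add_zero, Real.cos_neg]
  ring

theorem differentiable_analyticMode (n : ℕ) (θ A B : ℝ) :
    Differentiable ℂ (analyticMode n θ A B) := by
  unfold analyticMode
  fun_prop

theorem analyticMode_congr (n : ℕ) (θ A B : ℝ) {w w' : ℂ} (h : Complex.exp w = Complex.exp w') :
    analyticMode n θ A B w = analyticMode n θ A B w' := by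
  simp only [analyticMode, neg_sub, Complex.exp_sub, Complex.exp_nat_mul, h]

/-- The elliptic harmonic `(A e^{nξ} + B e^{-nξ}) cos(nη - θ)`. -/
noncomputable def mode (l : ℝ) (n : ℕ) (θ A B : ℝ) (x : Plane) : ℝ :=
  (A * Real.exp (n * (ellipticCoords l x).1) + B * Real.exp (-(n * (ellipticCoords l x).1))) *
    Real.cos (n * (ellipticCoords l x).2 - θ)

/-- Equality of `e + 1/e` at two values forces them to be equal or inverse; the inverse case would
give real parts summing to 0. Hence off the focal segment the elliptic coordinates are unique up to
`2π` in the angle, which `analyticMode` does not see. -/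
theorem exp_eq_of_cosh_eq {w w' : ℂ} (h : Complex.cosh w = Complex.cosh w') (h0 : 0 < w.re)
    (h0' : 0 ≤ w'.re) : Complex.exp w = Complex.exp w' := by
  have e1 := Complex.exp_ne_zero w
  have e2 := Complex.exp_ne_zero w'
  have h2 : Complex.exp w + (Complex.exp w)⁻¹ = Complex.exp w' + (Complex.exp w')⁻¹ := by
    rw [← Complex.exp_neg, ← Complex.exp_neg, ← Complex.two_cosh, ← Complex.two_cosh, h]
  have h3 : (Complex.exp w - Complex.exp w') * (Complex.exp w * Complex.exp w' - 1) = 0 := by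
    field_simp at h2
    linear_combination h2
  rcases mul_eq_zero.1 h3 with h4 | h4
  · exact sub_eq_zero.1 h4
  · have h5 := congrArg norm (sub_eq_zero.1 h4)
    rw [← Complex.exp_add, Complex.norm_exp, norm_one, Real.exp_eq_one_iff, Complex.add_re] at h5
    linarith

theorem mode_toPlane_cosh {l : ℝ} (hl : 0 < l) (n : ℕ) (θ A B : ℝ) {w : ℂ} (hw : 0 < w.re) :
    mode l n θ A B (toPlane (l * Complex.cosh w)) = (analyticMode n θ A B w).re := by
  obtain ⟨h0, -, -, h⟩ := ellipticCoords_spec hl (toPlane (l * Complex.cosh w))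
  rw [← toPlane_cosh] at h
  have h1 := toPlane.injective h
  have h2 := mul_left_cancel₀ (Complex.ofReal_ne_zero.2 hl.ne') h1
  rw [mode, ← analyticMode_re]
  rw [analyticMode_congr n θ A B (exp_eq_of_cosh_eq h2.symm hw (by simpa using h0))]

theorem mode_ellipticPoint {l : ℝ} (hl : 0 < l) (n : ℕ) (θ A B : ℝ) {ξ : ℝ} (hξ : 0 < ξ) (η : ℝ) :
    mode l n θ A B (ellipticPoint l ξ η) =
      (A * Real.exp (n * ξ) + B * Real.exp (-(n * ξ))) * Real.cos (n * η - θ) := by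
  rw [← toPlane_cosh, mode_toPlane_cosh hl n θ A B (by simpa using hξ), analyticMode_re]

theorem sinh_ne_zero_of_re_pos {w : ℂ} (hw : 0 < w.re) : Complex.sinh w ≠ 0 := by
  intro h
  have h1 : Complex.exp w = Complex.exp (-w) := by
    have := Complex.two_sinh w
    rw [h, mul_zero] at this
    exact (sub_eq_zero.1 this.symm)
  have h2 := congrArg norm h1
  rw [Complex.norm_exp, Complex.norm_exp, Real.exp_eq_exp, Complex.neg_re] at h2
  linarith

/-- Locally the function is the real part of `analyticMode` composed with a holomorphic inverse of
`l cosh`, which exists because the derivative `l sinh w` does not vanish for `Re w > 0`. -/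
theorem harmonicAt_mode {l : ℝ} (hl : 0 < l) (n : ℕ) (θ A B : ℝ) {ξ : ℝ} (hξ : 0 < ξ) (η : ℝ) :
    HarmonicAt (mode l n θ A B) (ellipticPoint l ξ η) := by
  set w : ℂ := ξ + η * Complex.I with hw
  have hwre : 0 < w.re := by simpa [hw] using hξ
  set c : ℂ → ℂ := fun w => l * Complex.cosh w with hc
  have hcd : ∀ w, HasDerivAt c (l * Complex.sinh w) w := fun w =>
    (Complex.hasDerivAt_cosh w).const_mul _
  have hca : AnalyticAt ℂ c w :=
    Differentiable.analyticAt (fun w => (hcd w).differentiableAt) w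
  have hc' : deriv c w ≠ 0 := by
    rw [(hcd w).deriv]
    exact mul_ne_zero (Complex.ofReal_ne_zero.2 hl.ne') (sinh_ne_zero_of_re_pos hwre)
  set L := hca.hasStrictDerivAt.localInverse _ _ _ hc' with hL
  have hLa : AnalyticAt ℂ L (c w) := hca.analyticAt_localInverse hc'
  have hLw : L (c w) = w := HasStrictFDerivAt.localInverse_apply_image ..
  have hLr : ∀ᶠ z in 𝓝 (c w), c (L z) = z := HasStrictDerivAt.eventually_right_inverse ..
  -- Positivity of the real part ensures that the branch `L` gives elliptic coordinates up to a
  -- multiple of `2π`.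
  have hLp : ∀ᶠ z in 𝓝 (c w), 0 < (L z).re := by
    have : Tendsto (fun z => (L z).re) (𝓝 (c w)) (𝓝 w.re) := by
      have h := Complex.continuous_re.continuousAt.tendsto.comp hLa.continuousAt.tendsto
      rwa [hLw] at h
    exact this.eventually (lt_mem_nhds hwre)
  have hF : AnalyticAt ℂ (fun z => analyticMode n θ A B (L z)) (c w) :=
    ((differentiable_analyticMode n θ A B).analyticAt _).comp hLa
  have hH := harmonicAt_comp_toPlane_symm hF.harmonicAt_re
  rw [hc, hw, toPlane_cosh] at hH
  refine (harmonicAt_congr_nhds ?_).1 hH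
  have ht : Tendsto toPlane.symm (𝓝 (ellipticPoint l ξ η)) (𝓝 (c w)) := by
    have h := toPlane.symm.continuous.tendsto (toPlane (c w))
    rwa [toPlane.symm_apply_apply, hc, hw, toPlane_cosh] at h
  filter_upwards [ht.eventually hLr, ht.eventually hLp] with x h1 h2
  have h3 := mode_toPlane_cosh hl n θ A B h2
  have h4 : toPlane (l * Complex.cosh (L (toPlane.symm x))) = x := by
    rw [← toPlane.apply_symm_apply x]
    exact congrArg toPlane (by simpa using h1)
  rw [h4] at h3
  exact h3.symm

theorem harmonicAt_mode_of_pos {l r : ℝ} (hl : 0 < l) (hr : 0 < r) (n : ℕ) (θ A B : ℝ) {x : Plane}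
    (hx : 0 ≤ ellipseForm l r x) : HarmonicAt (mode l n θ A B) x := by
  obtain ⟨⟨ξ, η⟩, h0, -, -, rfl⟩ := exists_ellipticCoords hl x
  refine harmonicAt_mode hl n θ A B ?_ η
  by_contra! hc
  exact hx.not_gt (ellipseForm_ellipticPoint_neg hl hr h0 (hc.trans_lt hr) η)

/-- The normal derivative of all elliptic harmonics at a point of an ellipse, up to a common
factor, is the derivative in the elliptic radius. -/
theorem exists_inner_gradient_mode {l r : ℝ} (hl : 0 < l) (hr : 0 < r) (η : ℝ) :
    ∃ κ : ℝ, ∀ (n : ℕ) (θ A B : ℝ),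
      inner ℝ (∇ (mode l n θ A B) (ellipticPoint l r η))
          (outwardNormal (ellipse l r) (ellipticPoint l r η)) =
        κ * (n * (A * Real.exp (n * r) - B * Real.exp (-(n * r))) * Real.cos (n * η - θ)) := by
  set x := ellipticPoint l r η with hx
  have hρ : ellipseForm l r x = 0 := ellipseForm_ellipticPoint_self hl hr η
  -- `τ` is the `ξ`-derivative of the point. Elliptic coordinates are orthogonal, so `τ` is parallel
  -- to the normal.
  set τ : Plane := !₂[l * Real.sinh r * Real.cos η, l * Real.cosh r * Real.sin η] with hτ
  have hd : HasDerivAt (fun ξ => ellipticPoint l ξ η) τ r := by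
    refine (PiLp.continuousLinearEquiv 2 ℝ fun _ : Fin 2 => ℝ).symm.hasFDerivAt.comp_hasDerivAt r
      (f := fun ξ => ![l * Real.cosh ξ * Real.cos η, l * Real.sinh ξ * Real.sin η])
      (f' := ![l * Real.sinh r * Real.cos η, l * Real.cosh r * Real.sin η]) (hasDerivAt_pi.2 ?_)
    intro i
    fin_cases i
    · simpa using
        ((Real.hasDerivAt_cosh r).const_mul l).mul_const (Real.cos η)
    · simpa using
        ((Real.hasDerivAt_sinh r).const_mul l).mul_const (Real.sin η)
  have hs := Real.sinh_pos_iff.2 hr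
  have hch := Real.cosh_pos r
  have hg : ellipseGrad l r x = (2 / (l ^ 2 * Real.sinh r * Real.cosh r)) • τ := by
    ext i
    fin_cases i
    · simp [ellipseGrad, hx, ellipticPoint, hτ]
      field_simp
    · simp [ellipseGrad, hx, ellipticPoint, hτ]
      field_simp
  refine ⟨‖ellipseGrad l r x‖⁻¹ * (2 / (l ^ 2 * Real.sinh r * Real.cosh r)), fun n θ A B => ?_⟩
  rw [outwardNormal_ellipse hl hr hρ, hg, smul_smul, ← hg, real_inner_smul_right]
  congr 1
  rw [inner_gradient_left]
  have hm := ((harmonicAt_mode hl n θ A B hr η).1.differentiableAt two_ne_zero).hasFDerivAt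
  have h1 : HasDerivAt (fun ξ => mode l n θ A B (ellipticPoint l ξ η))
      (fderiv ℝ (mode l n θ A B) x τ) r :=
    HasFDerivAt.comp_hasDerivAt (l := mode l n θ A B) r hm hd
  have h2 : HasDerivAt (fun ξ : ℝ => (A * Real.exp (n * ξ) + B * Real.exp (-(n * ξ))) *
      Real.cos (n * η - θ))
      (n * (A * Real.exp (n * r) - B * Real.exp (-(n * r))) * Real.cos (n * η - θ)) r := by
    have e : HasDerivAt (fun ξ : ℝ => n * ξ) (n : ℝ) r := by
      simpa using (hasDerivAt_id r).const_mul (n : ℝ)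
    refine ((((e.exp).const_mul A).fun_add ((e.fun_neg.exp).const_mul B)).mul_const
      (Real.cos (n * η - θ))).congr_deriv ?_
    ring
  refine h1.unique (h2.congr_of_eventuallyEq ?_)
  filter_upwards [lt_mem_nhds hr] with ξ hξ
  exact mode_ellipticPoint hl n θ A B hξ η

theorem norm_ellipticPoint_le {l ξ : ℝ} (hl : 0 < l) (hξ : 0 ≤ ξ) (η : ℝ) :
    ‖ellipticPoint l ξ η‖ ≤ l * Real.exp ξ := by
  have h1 : ‖ellipticPoint l ξ η‖ ≤ l * Real.cosh ξ := by
    refine abs_le_of_sq_le_sq' ?_ (by positivity) |>.2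
    rw [norm_sq_plane]
    simp only [ellipticPoint, Matrix.cons_val_zero, Matrix.cons_val_one]
    have h2 := Real.sin_sq_add_cos_sq η
    have h3 := Real.cosh_sq ξ
    have h4 : (l * Real.cosh ξ * Real.cos η) ^ 2 + (l * Real.sinh ξ * Real.sin η) ^ 2 =
        (l * Real.cosh ξ) ^ 2 - (l * Real.sin η) ^ 2 := by
      linear_combination (l ^ 2 * Real.cosh ξ ^ 2) * h2 - (l ^ 2 * Real.sin η ^ 2) * h3
    rw [h4]
    linarith [sq_nonneg (l * Real.sin η)]
  refine h1.trans (mul_le_mul_of_nonneg_left ?_ hl.le)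
  rw [← Real.cosh_add_sinh ξ]
  linarith [Real.sinh_nonneg_iff.2 hξ]

/-- Since `|x| ≤ l e^ξ`, the bound `e^{-nξ} ≤ e^{-ξ} ≤ l / |x|` holds for `n ≥ 1`. -/
theorem mode_isBigO {l : ℝ} (hl : 0 < l) {n : ℕ} (hn : 1 ≤ n) (θ B : ℝ) :
    mode l n θ 0 B =O[Bornology.cobounded Plane] fun x => ‖x‖⁻¹ := by
  refine IsBigO.of_bound (|B| * l) ?_
  filter_upwards [tendsto_norm_cobounded_atTop.eventually_gt_atTop 0] with x hxn
  obtain ⟨h0, -, -, h⟩ := ellipticCoords_spec hl x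
  have h1 := norm_ellipticPoint_le hl h0 (ellipticCoords l x).2
  rw [h] at h1
  set ξ := (ellipticCoords l x).1 with hξ
  have h2 : Real.exp (-(n * ξ)) ≤ Real.exp (-ξ) := by
    refine Real.exp_le_exp.2 (neg_le_neg ?_)
    have : (1 : ℝ) ≤ n := by exact_mod_cast hn
    nlinarith
  have h3 : Real.exp (-ξ) ≤ l * ‖x‖⁻¹ := by
    rw [Real.exp_neg, ← div_eq_mul_inv, inv_le_comm₀ (Real.exp_pos _) (by positivity), inv_div,
      div_le_iff₀ hl, mul_comm]
    exact h1
  rw [norm_inv, norm_norm, mode, ← hξ, zero_mul, zero_add, norm_mul, norm_mul, Real.norm_eq_abs,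
    Real.norm_eq_abs, Real.norm_eq_abs, Real.abs_exp]
  calc |B| * Real.exp (-(n * ξ)) * |Real.cos (n * (ellipticCoords l x).2 - θ)|
      ≤ |B| * Real.exp (-(n * ξ)) * 1 :=
        mul_le_mul_of_nonneg_left (Real.abs_cos_le_one _) (by positivity)
    _ = |B| * Real.exp (-(n * ξ)) := mul_one _
    _ ≤ |B| * (l * ‖x‖⁻¹) := mul_le_mul_of_nonneg_left (h2.trans h3) (abs_nonneg B)
    _ = |B| * l * ‖x‖⁻¹ := by ring

theorem fieldCos_eq_mode (l : ℝ) (n : ℕ) : fieldCos l n = mode l n 0 (1 / 2) (1 / 2) := by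
  funext x
  rw [fieldCos, mode, Real.cosh_eq, sub_zero]
  ring

theorem fieldSin_eq_mode (l : ℝ) (n : ℕ) :
    fieldSin l n = mode l n (Real.pi / 2) (1 / 2) (-(1 / 2)) := by
  funext x
  rw [fieldSin, mode, Real.sinh_eq, Real.cos_sub_pi_div_two]
  ring

/-! ### The explicit solutions -/

theorem mode_sub (l : ℝ) (n : ℕ) (θ A B A' B' : ℝ) (x : Plane) :
    mode l n θ A B x - mode l n θ A' B' x = mode l n θ (A - A') (B - B') x := by
  simp only [mode]
  ring

theorem mul_mode (l : ℝ) (n : ℕ) (θ A B c : ℝ) (x : Plane) :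
    c * mode l n θ A B x = mode l n θ (c * A) (c * B) x := by
  simp only [mode]
  ring

/-- Two elliptic harmonics glued along the ellipse of elliptic radius `r`. -/
noncomputable def gluedMode (l r : ℝ) (n : ℕ) (θ Ai Bi Ae Be : ℝ) (x : Plane) : ℝ :=
  if ellipseForm l r x ≤ 0 then mode l n θ Ai Bi x else mode l n θ Ae Be x

section Glued

variable {l r : ℝ} {n : ℕ} {θ Ai Bi Ae Be : ℝ} {x : Plane}

theorem gluedMode_eventuallyEq_inner (hx : ellipseForm l r x < 0) :
    gluedMode l r n θ Ai Bi Ae Be =ᶠ[𝓝 x] mode l n θ Ai Bi := by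
  filter_upwards [(isOpen_lt (continuous_ellipseForm l r) continuous_const).mem_nhds hx] with y hy
  exact if_pos (le_of_lt hy)

theorem gluedMode_eventuallyEq_outer (hx : 0 < ellipseForm l r x) :
    gluedMode l r n θ Ai Bi Ae Be =ᶠ[𝓝 x] mode l n θ Ae Be := by
  filter_upwards [(isOpen_lt continuous_const (continuous_ellipseForm l r)).mem_nhds hx] with y hy
  exact if_neg (not_le_of_gt hy)

theorem continuousOn_gluedMode {ρ : ℝ} (hl : 0 < l) (hρ : 0 < ρ) (hr : 0 < r)
    (hc : Ai * Real.exp (n * r) + Bi * Real.exp (-(n * r)) =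
      Ae * Real.exp (n * r) + Be * Real.exp (-(n * r))) :
    ContinuousOn (gluedMode l r n θ Ai Bi Ae Be) (ellipse l ρ)ᶜ := by
  have hm : ∀ A B, ContinuousOn (mode l n θ A B) (ellipse l ρ)ᶜ := fun A B y hy =>
    (harmonicAt_mode_of_pos hl hρ n θ A B
      ((mem_exterior_iff hl hρ y).1 hy)).1.continuousAt.continuousWithinAt
  refine ContinuousOn.if (fun y hy => ?_) ((hm Ai Bi).mono Set.inter_subset_left)
    ((hm Ae Be).mono Set.inter_subset_left)
  have h0 : ellipseForm l r y = 0 :=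
    frontier_le_subset_eq (continuous_ellipseForm l r) continuous_const hy.2
  obtain ⟨η, rfl⟩ := exists_ellipticPoint_of_ellipseForm_eq_zero hl hr h0
  rw [mode_ellipticPoint hl n θ Ai Bi hr, mode_ellipticPoint hl n θ Ae Be hr, hc]

end Glued

/-- The four hypotheses are the two Neumann conditions, continuity and the jump, after removal of
the common angular and metric factors. The growing coefficients at infinity are those of the
background; `a` and `b` are free because decaying parts are `O(|x|⁻¹)`. -/
theorem isSolution_mode {l ξi ξe : ℝ} (hl : 0 < l) (hi : 0 < ξi) (hie : ξi < ξe) {n : ℕ}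
    (hn : 1 ≤ n) (θ : ℝ) {ζ₀ A B a Ai Bi b : ℝ}
    (hφ : A * Real.exp (n * ξi) - a * Real.exp (-(n * ξi)) = 0)
    (hp : Ai * Real.exp (n * ξi) - Bi * Real.exp (-(n * ξi)) = 0)
    (hc : Ai * Real.exp (n * ξe) + Bi * Real.exp (-(n * ξe)) =
      12 * A * Real.exp (n * ξe) + b * Real.exp (-(n * ξe)))
    (hj : (12 * A * Real.exp (n * ξe) - b * Real.exp (-(n * ξe))) -
        (Ai * Real.exp (n * ξe) - Bi * Real.exp (-(n * ξe))) =
      12 * ζ₀ * (A * Real.exp (n * ξe) - a * Real.exp (-(n * ξe)))) :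
    IsSolution (ellipse l ξi) (ellipse l ξe) ζ₀ (mode l n θ A B) (fun x => 12 * mode l n θ A B x)
      (mode l n θ A a) (gluedMode l ξe n θ Ai Bi (12 * A) b) := by
  have he := hi.trans hie
  have hm : ∀ A B y, 0 ≤ ellipseForm l ξi y → HarmonicAt (mode l n θ A B) y := fun A B y hy =>
    harmonicAt_mode_of_pos hl hi n θ A B hy
  have hme : ∀ A B y, 0 ≤ ellipseForm l ξe y → HarmonicAt (mode l n θ A B) y := fun A B y hy =>
    harmonicAt_mode_of_pos hl he n θ A B hy
  refine ⟨?_, ?_, ?_, ?_, ?_, ?_, ?_, ?_, ?_⟩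
  · exact fun y hy => (hm A a y ((mem_exterior_iff hl hi y).1 hy)).1.continuousAt.continuousWithinAt
  · exact fun y hy => hm A a y ((mem_compl_closure_ellipse hl hi y).1 hy).le
  · intro y hy
    have hy0 := (mem_frontier_ellipse hl hi y).1 hy
    have h := HasOuterNormalDeriv.of_contDiffAt (U := ellipse l ξi) (hm A a y hy0.ge).1
      (Eventually.of_forall fun t => EventuallyEq.rfl)
    obtain ⟨η, rfl⟩ := exists_ellipticPoint_of_ellipseForm_eq_zero hl hi hy0
    obtain ⟨κ, hκ⟩ := exists_inner_gradient_mode hl hi η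
    rw [hκ, hφ] at h
    simpa using h
  · refine (mode_isBigO hl hn θ (a - B)).congr_left fun y => ?_
    rw [mode_sub, sub_self]
  · exact continuousOn_gluedMode hl hi he hc
  · rintro y ⟨hy, hy'⟩
    have h1 := ((mem_compl_closure_ellipse hl hi y).1 hy).le
    rw [mem_frontier_ellipse hl he] at hy'
    rcases lt_or_gt_of_ne hy' with h | h
    · exact (harmonicAt_congr_nhds (gluedMode_eventuallyEq_inner h)).2 (hm _ _ y h1)
    · exact (harmonicAt_congr_nhds (gluedMode_eventuallyEq_outer h)).2 (hm _ _ y h1)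
  · intro y hy
    have hy0 := (mem_frontier_ellipse hl hi y).1 hy
    have h := HasOuterNormalDeriv.of_contDiffAt (U := ellipse l ξi)
      (g := gluedMode l ξe n θ Ai Bi (12 * A) b) (hm Ai Bi y hy0.ge).1 (by
        filter_upwards [(tendsto_line_right y (outwardNormal (ellipse l ξi) y)).eventually
          ((isOpen_lt (continuous_ellipseForm l ξe) continuous_const).mem_nhds
            (ellipseForm_lt_of_lt hl hi hie hy0.le))] with t ht
        exact gluedMode_eventuallyEq_inner ht)
    obtain ⟨η, rfl⟩ := exists_ellipticPoint_of_ellipseForm_eq_zero hl hi hy0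
    obtain ⟨κ, hκ⟩ := exists_inner_gradient_mode hl hi η
    rw [hκ, hp] at h
    simpa using h
  · intro y hy
    have hy0 := (mem_frontier_ellipse hl he y).1 hy
    have ho := HasOuterNormalDeriv.of_contDiffAt (U := ellipse l ξe)
      (g := gluedMode l ξe n θ Ai Bi (12 * A) b) (hme (12 * A) b y hy0.ge).1 (by
        filter_upwards [self_mem_nhdsWithin] with t ht
        exact gluedMode_eventuallyEq_outer (ellipseForm_add_outwardNormal_pos hl he hy0 ht))
    have hi' := HasInnerNormalDeriv.of_contDiffAt (U := ellipse l ξe)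
      (g := gluedMode l ξe n θ Ai Bi (12 * A) b) (hme Ai Bi y hy0.ge).1 (by
        filter_upwards [ellipseForm_sub_outwardNormal_neg hl he hy0] with t ht
        exact gluedMode_eventuallyEq_inner ht)
    refine ⟨_, _, ho, hi', ?_⟩
    obtain ⟨η, rfl⟩ := exists_ellipticPoint_of_ellipseForm_eq_zero hl he hy0
    obtain ⟨κ, hκ⟩ := exists_inner_gradient_mode hl he η
    rw [hκ, hκ, hκ]
    -- The same `κ` serves all three normal derivatives, so it factors out.
    linear_combination (κ * n * Real.cos (n * η - θ)) * hj
  · refine (mode_isBigO hl hn θ (b - 12 * B)).congr' ?_ EventuallyEq.rfl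
    have hb : Bornology.IsBounded (closure (ellipse l ξe)) := by
      refine Bornology.IsBounded.closure ((Metric.isBounded_closedBall (x := (0 : Plane))
        (r := l * Real.exp ξe)).subset ?_)
      rintro _ ⟨ξ, η, h0, h, rfl⟩
      rw [mem_closedBall_zero_iff]
      exact (norm_ellipticPoint_le hl h0 η).trans
        (mul_le_mul_of_nonneg_left (Real.exp_le_exp.2 h.le) hl.le)
    filter_upwards [Bornology.isBounded_def.1 hb] with y hy
    have h := (mem_compl_closure_ellipse hl he y).1 hy
    rw [gluedMode, if_neg h.not_ge, mul_mode, mode_sub, sub_self]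

/-! ### From one explicit solution to cloaking and shielding -/

theorem isPerfectCloaking_of_isSolution {l ξi ξe : ℝ} (hl : 0 < l) (hi : 0 < ξi) (hie : ξi < ξe)
    {ζ₀ : ℝ} {H P φ p : Plane → ℝ} (h : IsSolution (ellipse l ξi) (ellipse l ξe) ζ₀ H P φ p)
    (hp : ∀ x ∈ (closure (ellipse l ξe))ᶜ, p x = P x) :
    IsPerfectCloaking (ellipse l ξi) (ellipse l ξe) ζ₀ H P := by
  have he := hi.trans hie
  refine ⟨⟨φ, p, h⟩, fun φ' p' h' x hx => ?_⟩
  have hz : zetaMean (ellipse l ξi) (ellipse l ξe) ζ₀ x = 0 :=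
    Set.indicator_of_notMem (fun hx' => hx (subset_closure hx'.1)) _
  have hg : ∇ p' x = ∇ P x := by
    refine EventuallyEq.gradient_eq ?_
    filter_upwards [isClosed_closure.isOpen_compl.mem_nhds hx] with y hy
    refine (h'.unique hl hi hie h ((mem_exterior_iff hl hi y).2 ?_)).trans (hp y hy)
    by_contra! hc
    exact (ellipseForm_lt_of_lt hl hi hie hc.le).not_gt ((mem_compl_closure_ellipse hl he y).1 hy)
  rw [averVelocity, hz, hg, zero_smul, sub_zero]

theorem isPerfectShielding_of_isSolution {l ξi ξe : ℝ} (hl : 0 < l) (hi : 0 < ξi) (hie : ξi < ξe)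
    {ζ₀ : ℝ} {H P φ p : Plane → ℝ} (h : IsSolution (ellipse l ξi) (ellipse l ξe) ζ₀ H P φ p)
    (hp : ∀ x ∈ frontier (ellipse l ξi), p x = 0) :
    IsPerfectShielding (ellipse l ξi) (ellipse l ξe) ζ₀ H P := by
  refine ⟨⟨φ, p, h⟩, fun φ' p' h' => ?_⟩
  refine setIntegral_eq_zero_of_forall_eq_zero fun x hx => ?_
  rw [h'.unique hl hi hie h
    ((mem_exterior_iff hl hi x).2 ((mem_frontier_ellipse hl hi x).1 hx).ge), hp x hx, neg_zero,
    zero_smul]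

section Values

variable {l ξi ξe : ℝ} {n : ℕ}

/-- Between the ellipses `p` has radial part `C cosh(n(ξ - ξi))`, which meets the Neumann condition
for every `C`; outside it is exactly the background. `hc` is continuity and `hj` the jump at `ξe`.
-/
theorem isPerfectCloaking_mode (hl : 0 < l) (hi : 0 < ξi) (hie : ξi < ξe) (hn : 1 ≤ n)
    (θ : ℝ) {A B a C ζ₀ : ℝ}
    (hφ : A * Real.exp (n * ξi) - a * Real.exp (-(n * ξi)) = 0)
    (hc : C * Real.cosh (n * (ξe - ξi)) =
      12 * A * Real.exp (n * ξe) + 12 * B * Real.exp (-(n * ξe)))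
    (hj : (12 * A * Real.exp (n * ξe) - 12 * B * Real.exp (-(n * ξe))) -
        C * Real.sinh (n * (ξe - ξi)) =
      12 * ζ₀ * (A * Real.exp (n * ξe) - a * Real.exp (-(n * ξe)))) :
    IsPerfectCloaking (ellipse l ξi) (ellipse l ξe) ζ₀ (mode l n θ A B)
      (fun x => 12 * mode l n θ A B x) := by
  have he := hi.trans hie
  have e1 : Real.exp (n * (ξe - ξi)) = Real.exp (n * ξe) * Real.exp (-(n * ξi)) := by
    rw [← Real.exp_add]
    ring_nf
  have e2 : Real.exp (-(n * (ξe - ξi))) = Real.exp (-(n * ξe)) * Real.exp (n * ξi) := by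
    rw [← Real.exp_add]
    ring_nf
  rw [Real.cosh_eq, e1, e2] at hc
  rw [Real.sinh_eq, e1, e2] at hj
  refine isPerfectCloaking_of_isSolution hl hi hie
    (isSolution_mode hl hi hie hn θ (Ai := C / 2 * Real.exp (-(n * ξi)))
      (Bi := C / 2 * Real.exp (n * ξi)) (b := 12 * B) hφ (by ring) (by linear_combination hc)
      (by linear_combination hj)) fun x hx => ?_
  rw [gluedMode, if_neg ((mem_compl_closure_ellipse hl he x).1 hx).not_ge, mul_mode]

/-- The pressure is made to vanish identically between the ellipses, so the integrand of the force
is zero pointwise. Continuity at `ξe` then fixes the outer decaying coefficient `b`. -/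
theorem isPerfectShielding_mode (hl : 0 < l) (hi : 0 < ξi) (hie : ξi < ξe) (hn : 1 ≤ n)
    (θ : ℝ) {A B a ζ₀ : ℝ}
    (hφ : A * Real.exp (n * ξi) - a * Real.exp (-(n * ξi)) = 0)
    (hj : 2 * A * Real.exp (n * ξe) =
      ζ₀ * (A * Real.exp (n * ξe) - a * Real.exp (-(n * ξe)))) :
    IsPerfectShielding (ellipse l ξi) (ellipse l ξe) ζ₀ (mode l n θ A B)
      (fun x => 12 * mode l n θ A B x) := by
  have hE : Real.exp (n * ξe) * Real.exp (-(n * ξe)) = 1 := by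
    rw [← Real.exp_add, add_neg_cancel, Real.exp_zero]
  refine isPerfectShielding_of_isSolution hl hi hie
    (isSolution_mode hl hi hie hn θ (Ai := 0) (Bi := 0)
      (b := -(12 * A * Real.exp (n * ξe) ^ 2)) hφ (by ring)
      (by linear_combination (12 * A * Real.exp (n * ξe)) * hE)
      (by linear_combination 12 * hj + (12 * A * Real.exp (n * ξe)) * hE)) fun x hx => ?_
  have h := (ellipseForm_lt_of_lt hl hi hie ((mem_frontier_ellipse hl hi x).1 hx).le).le
  rw [gluedMode, if_pos h, mode]
  ring

/-- The common value of the denominators. -/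
theorem sinh_sub_exp_mul_sinh (n : ℕ) (ξi ξe : ℝ) :
    Real.sinh (n * ξe) - Real.exp (n * (ξi - ξe)) * Real.sinh (n * ξi) =
      1 / 2 * Real.exp (n * ξe) - Real.exp (n * ξi) ^ 2 / 2 * Real.exp (-(n * ξe)) := by
  have e1 : Real.exp (n * (ξi - ξe)) = Real.exp (n * ξi) * Real.exp (-(n * ξe)) := by
    rw [← Real.exp_add]
    ring_nf
  have e2 : Real.exp (n * ξi) * Real.exp (-(n * ξi)) = 1 := by
    rw [← Real.exp_add, add_neg_cancel, Real.exp_zero]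
  rw [Real.sinh_eq, Real.sinh_eq, e1]
  linear_combination Real.exp (-(n * ξe)) / 2 * e2

/-- By `cosh - sinh = e^{-·}`, the two sides differ by `e^{-nξe} - e^{n(ξi-ξe)} e^{-nξi} = 0`. Both
backgrounds have the same growing part, hence the same `φ` and the same flux through `∂Ω`. -/
theorem cosh_sub_exp_mul_cosh (n : ℕ) (ξi ξe : ℝ) :
    Real.cosh (n * ξe) - Real.exp (n * (ξi - ξe)) * Real.cosh (n * ξi) =
      Real.sinh (n * ξe) - Real.exp (n * (ξi - ξe)) * Real.sinh (n * ξi) := by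
  have e : Real.exp (n * (ξi - ξe)) * Real.exp (-(n * ξi)) = Real.exp (-(n * ξe)) := by
    rw [← Real.exp_add]
    ring_nf
  have h1 := Real.cosh_sub_sinh (n * ξe)
  have h2 := Real.cosh_sub_sinh (n * ξi)
  linear_combination h1 - Real.exp (n * (ξi - ξe)) * h2 - e

theorem sinh_sub_exp_mul_sinh_pos (hie : ξi < ξe) (hn : 1 ≤ n) :
    0 < Real.sinh (n * ξe) - Real.exp (n * (ξi - ξe)) * Real.sinh (n * ξi) := by
  have hn' : (0 : ℝ) < n := by exact_mod_cast hn
  have e : Real.exp (n * ξi) ^ 2 * Real.exp (-(n * ξe)) < Real.exp (n * ξe) := by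
    rw [sq, ← Real.exp_add, ← Real.exp_add]
    refine Real.exp_lt_exp.2 ?_
    nlinarith
  rw [sinh_sub_exp_mul_sinh]
  linarith

/-- The growing coefficient is `1 / 2` for both backgrounds, which forces the decaying coefficient
`e^{2nξi} / 2` of `φ`. -/
theorem neumann_coefficient (n : ℕ) (ξi : ℝ) :
    1 / 2 * Real.exp (n * ξi) - Real.exp (n * ξi) ^ 2 / 2 * Real.exp (-(n * ξi)) = 0 := by
  have e : Real.exp (n * ξi) * Real.exp (-(n * ξi)) = 1 := by
    rw [← Real.exp_add, add_neg_cancel, Real.exp_zero]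
  linear_combination -(Real.exp (n * ξi) / 2) * e

end Values

end ElectroOsmosis

theorem mainTheorem2 (l ξi ξe : ℝ) (hl : 0 < l) (hi : 0 < ξi) (hie : ξi < ξe)
    (n : ℕ) (hn : 1 ≤ n) :
    (IsPerfectCloaking (ellipse l ξi) (ellipse l ξe)
        (Real.sinh (n * ξi) /
          ((Real.sinh (n * ξe) - Real.exp (n * (ξi - ξe)) * Real.sinh (n * ξi)) *
            Real.cosh (n * (ξe - ξi))))
        (fieldCos l n) (fun x => 12 * fieldCos l n x) ∧
      IsPerfectShielding (ellipse l ξi) (ellipse l ξe)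
        (Real.exp (n * ξe) /
          (Real.sinh (n * ξe) - Real.exp (n * (ξi - ξe)) * Real.sinh (n * ξi)))
        (fieldCos l n) (fun x => 12 * fieldCos l n x)) ∧
    (IsPerfectCloaking (ellipse l ξi) (ellipse l ξe)
        (Real.cosh (n * ξi) /
          ((Real.cosh (n * ξe) - Real.exp (n * (ξi - ξe)) * Real.cosh (n * ξi)) *
            Real.cosh (n * (ξe - ξi))))
        (fieldSin l n) (fun x => 12 * fieldSin l n x) ∧
      IsPerfectShielding (ellipse l ξi) (ellipse l ξe)
        (Real.exp (n * ξe) /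
          (Real.cosh (n * ξe) - Real.exp (n * (ξi - ξe)) * Real.cosh (n * ξi)))
        (fieldSin l n) (fun x => 12 * fieldSin l n x)) ∧
    Real.exp (n * ξe) /
        (Real.sinh (n * ξe) - Real.exp (n * (ξi - ξe)) * Real.sinh (n * ξi)) =
      Real.exp (n * ξe) /
        (Real.cosh (n * ξe) - Real.exp (n * (ξi - ξe)) * Real.cosh (n * ξi)) := by
  have hK := sinh_sub_exp_mul_sinh_pos hie hn
  have hc := Real.cosh_pos (n * (ξe - ξi))
  have hφ := neumann_coefficient n ξi
  have hsub : n * ξi = n * ξe - n * (ξe - ξi) := by ring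
  refine ⟨⟨?_, ?_⟩, ⟨?_, ?_⟩, ?_⟩
  · rw [fieldCos_eq_mode]
    refine isPerfectCloaking_mode hl hi hie hn 0
      -- `C` is forced by continuity of the pressure at `ξe`.
      (C := 12 * Real.cosh (n * ξe) / Real.cosh (n * (ξe - ξi))) hφ ?_ ?_
    · rw [div_mul_cancel₀ _ hc.ne', Real.cosh_eq]
      ring
    · rw [← sinh_sub_exp_mul_sinh, div_mul_eq_div_div]
      -- The subtraction formula collapses the jump of the pressure to a multiple of `sinh(nξi)`,
      -- the numerator of `ζ₀`.
      have h : Real.sinh (n * ξi) = Real.sinh (n * ξe) * Real.cosh (n * (ξe - ξi)) -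
          Real.cosh (n * ξe) * Real.sinh (n * (ξe - ξi)) := by
        rw [hsub, Real.sinh_sub]
      have hs : 12 * (1 / 2) * Real.exp (n * ξe) - 12 * (1 / 2) * Real.exp (-(n * ξe)) =
          12 * Real.sinh (n * ξe) := by
        rw [Real.sinh_eq]
        ring
      rw [hs]
      -- The flux factor `K` cancels against the denominator of `ζ₀`; only `K ≠ 0` matters.
      generalize Real.sinh (n * ξe) - Real.exp (n * (ξi - ξe)) * Real.sinh (n * ξi) = K at hK ⊢
      have := hK.ne'
      field_simp
      linear_combination -h
  · rw [fieldCos_eq_mode]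
    refine isPerfectShielding_mode hl hi hie hn 0 hφ ?_
    rw [← sinh_sub_exp_mul_sinh, div_mul_cancel₀ _ hK.ne']
    ring
  · rw [fieldSin_eq_mode, cosh_sub_exp_mul_cosh]
    refine isPerfectCloaking_mode hl hi hie hn (Real.pi / 2)
      (C := 12 * Real.sinh (n * ξe) / Real.cosh (n * (ξe - ξi))) hφ ?_ ?_
    · rw [div_mul_cancel₀ _ hc.ne', Real.sinh_eq]
      ring
    · rw [← sinh_sub_exp_mul_sinh, div_mul_eq_div_div]
      have h : Real.cosh (n * ξi) = Real.cosh (n * ξe) * Real.cosh (n * (ξe - ξi)) -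
          Real.sinh (n * ξe) * Real.sinh (n * (ξe - ξi)) := by
        rw [hsub, Real.cosh_sub]
      have hs : 12 * (1 / 2) * Real.exp (n * ξe) - 12 * -(1 / 2) * Real.exp (-(n * ξe)) =
          12 * Real.cosh (n * ξe) := by
        rw [Real.cosh_eq]
        ring
      rw [hs]
      generalize Real.sinh (n * ξe) - Real.exp (n * (ξi - ξe)) * Real.sinh (n * ξi) = K at hK ⊢
      have := hK.ne'
      field_simp
      linear_combination -h
  · rw [fieldSin_eq_mode, cosh_sub_exp_mul_cosh]
    refine isPerfectShielding_mode hl hi hie hn (Real.pi / 2) hφ ?_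
    rw [← sinh_sub_exp_mul_sinh, div_mul_cancel₀ _ hK.ne']
    ring
  · rw [cosh_sub_exp_mul_cosh]
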